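/- **Theorem (Full bound of the single index model).** Fix constants $L_f, L_{f'}, M, C_{\max}, \mu_0, A, B>0$ and $\sigma\ge 0$. There is a constant $C$, depending only on these, such that the following holds for all $n,d$ with $d^6\le A\,n$. *Model.* Let $f:\mathbb R\to\mathbb R$ be continuously differentiable with $|f|\le L_f$ and $|f'|\le L_{f'}$ on $\mathbb R$. Let $\mathcal D=N(\mu_X,\Sigma_X)$ on $\mathbb R^d$ with $\Sigma_X$ positive definite, density $p$ and score $S=-\nabla p/p$, and assume $\lambda_{\max}(\Sigma_X)\le C_{\max}$ and $\mathbb E_{X\sim\mathcal D}[S_j(X)^2]\le M$ for all $j\le d$. Let $\theta_*\in\mathbb R^d$ satisfy $\|\Sigma_X^{1/2}\theta_*\|_1=1$ and $\mu_*=\mathbb E_{X\sim\mathcal D}[f'(X^\top\theta_*)]\ge\mu_0$. We observe two batches of $n$ samples $(x_i,y_i)$, with $y_i=f(x_i^\top\theta_*)+\eta_i$, where the $2n$ pairs $(x_i,\eta_i)$ are independent, $x_i\sim\mathcal D$, and $\eta_i$ is independent of $x_i$ with mean zero and variance at most $\sigma^2$. Let $X\sim\mathcal D$ be independent of all the samples.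 *Estimators.* Let $\delta\in(0,1)$ with $\log(1/\delta)\le B\,n^{1/3}$ (for instance a fixed $\delta$), and $\tau=\sqrt{3(\sigma^2+L_f^2)Mn/\log(2d/\delta)}$. With the first batch let $\hat\theta$ be the minimizer over $\theta\in\mathbb R^d$ of $$\|\theta\|_2^2-\frac2n\sum_{i=1}^n\phi_\tau\bigl(y_iS(x_i)\bigr)^\top\theta,\qquad \phi_\tau(v)=\bigl(\operatorname{sign}(v_j)(|v_j|\wedge\tau)\bigr)_{j=1}^d,$$ and let $\hat\theta_0=\hat\theta/\|\Sigma_X^{1/2}\hat\theta\|_1$ (and $\hat\theta_0=0$ if $\hat\theta=0$). With the second batch let, for $h=n^{-1/3}$, $W=2\sqrt{\log n}$ and $K_h(v)=\frac1h 1_{\{|v|\le h\}}$, $$\hat f(z)=\frac{\sum_{i=1}^n y_iK_h(z-x_i^\top\hat\theta_0)}{\sum_{i=1}^nK_h(z-x_i^\top\hat\theta_0)}\ \text{ if } |z-\mu_X^\top\hat\theta_0|\le W,\qquad \hat f(z)=0\ \text{ otherwise},$$ with the convention $0/0=0$. *Conclusion.* With probability at least $1-\delta$ over the first batch, the expectation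 over $X$ and the second batch, given the first batch, satisfies $$\mathbb E\bigl|\hat f(X^\top\hat\theta_0)-f(X^\top\theta_*)\bigr|\le C\,\frac{\sqrt d}{n^{1/3}},$$ and the same bound holds for the expectation over $X$ and both batches. (In both cases the integrand is integrable.) -/

import Mathlib

open MeasureTheory ProbabilityTheory
open scoped Matrix MatrixOrder

noncomputable section

namespace SingleIndex

/-- The density of the Gaussian distribution `N(m, Q)` on `ℝ^d` (with `Q` positive definite). -/
def gaussianDensity {d : ℕ} (m : EuclideanSpace ℝ (Fin d)) (Q : Matrix (Fin d) (Fin d) ℝ)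
    (x : EuclideanSpace ℝ (Fin d)) : ℝ :=
  (2 * Real.pi) ^ (-(d : ℝ) / 2) * (Real.sqrt Q.det)⁻¹ *
    Real.exp (-((x - m).ofLp ⬝ᵥ (Q⁻¹ *ᵥ (x - m).ofLp)) / 2)

/-- The score function `S^p(x) = -∇p(x) / p(x)` of a density `p` on `ℝ^d`. -/
def score {d : ℕ} (p : EuclideanSpace ℝ (Fin d) → ℝ) (x : EuclideanSpace ℝ (Fin d)) :
    EuclideanSpace ℝ (Fin d) :=
  -((p x)⁻¹ • gradient p x)

/-- The `ℓ¹` norm of a vector of `ℝ^d`. -/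
def l1norm {d : ℕ} (v : EuclideanSpace ℝ (Fin d)) : ℝ := ∑ j, |v j|

/-- The vector `Q^{1/2} v`, where `Q^{1/2}` is the positive semidefinite square root of `Q`. -/
def sqrtMul {d : ℕ} (Q : Matrix (Fin d) (Fin d) ℝ) (v : EuclideanSpace ℝ (Fin d)) :
    EuclideanSpace ℝ (Fin d) :=
  WithLp.toLp 2 (CFC.sqrt Q *ᵥ v.ofLp)

/-- Elementwise truncation: `φ_τ(v)_j = sign(v_j) (|v_j| ∧ τ)`. -/
def trunc {d : ℕ} (τ : ℝ) (v : EuclideanSpace ℝ (Fin d)) : EuclideanSpace ℝ (Fin d) :=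
  WithLp.toLp 2 fun j => Real.sign (v j) * min |v j| τ

/-- The regularized Stein objective
`‖θ‖₂² - (2/n) ∑ᵢ ⟨φ_τ(yᵢ S(xᵢ)), θ⟩ + lam ‖θ‖₁` built from the samples `(xᵢ, yᵢ)`, `i < n`. -/
def steinObjective {n d : ℕ} (S : EuclideanSpace ℝ (Fin d) → EuclideanSpace ℝ (Fin d))
    (τ lam : ℝ) (x : Fin n → EuclideanSpace ℝ (Fin d)) (y : Fin n → ℝ)
    (θ : EuclideanSpace ℝ (Fin d)) : ℝ :=
  ‖θ‖ ^ 2 - 2 / (n : ℝ) * ∑ i, inner ℝ (trunc τ (y i • S (x i))) θ + lam * l1norm θ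

/-- The normalization `θ / ‖Q^{1/2} θ‖₁` (equal to `0` if `θ = 0`). -/
def normalize {d : ℕ} (Q : Matrix (Fin d) (Fin d) ℝ) (θ : EuclideanSpace ℝ (Fin d)) :
    EuclideanSpace ℝ (Fin d) :=
  (l1norm (sqrtMul Q θ))⁻¹ • θ

/-- The uniform kernel `K_h(v) = h⁻¹ 1{|v| ≤ h}`. -/
def uniformKernel (h v : ℝ) : ℝ := if |v| ≤ h then 1 / h else 0

/-- The truncated kernel regression estimator of the link function, computed in direction `ϑ`
from the samples `(xᵢ, yᵢ)`, `i < n`, with bandwidth `h` and truncation level `W` around `mᵀϑ`;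
the convention `0 / 0 = 0` is that of Lean. -/
def kernelRegression {n d : ℕ} (m : EuclideanSpace ℝ (Fin d)) (h W : ℝ)
    (ϑ : EuclideanSpace ℝ (Fin d)) (x : Fin n → EuclideanSpace ℝ (Fin d)) (y : Fin n → ℝ)
    (z : ℝ) : ℝ :=
  if |z - inner ℝ m ϑ| ≤ W then
    (∑ i, y i * uniformKernel h (z - inner ℝ (x i) ϑ)) /
      ∑ i, uniformKernel h (z - inner ℝ (x i) ϑ)
  else 0

/-- The absolute prediction error `|f̂(uᵀϑ) - f(uᵀθ)|` at the context `u`, where `f̂` is the kernel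
regression estimator in direction `ϑ` from `n` samples `(xᵢ, yᵢ)`, with bandwidth `h = n^{-1/3}`
and truncation level `W = 2 √(log n)`. -/
def predictionError {n d : ℕ} (f : ℝ → ℝ) (θ m : EuclideanSpace ℝ (Fin d))
    (ϑ : EuclideanSpace ℝ (Fin d)) (x : Fin n → EuclideanSpace ℝ (Fin d)) (y : Fin n → ℝ)
    (u : EuclideanSpace ℝ (Fin d)) : ℝ :=
  |kernelRegression m ((n : ℝ) ^ (-(1 : ℝ) / 3)) (2 * Real.sqrt (Real.log n)) ϑ x y (inner ℝ u ϑ)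
    - f (inner ℝ u θ)|

end SingleIndex

end

/-! Write `h = n^{-1/3}`. For `X ~ N(m, Q)` the score is `Q⁻¹ (X - m)`, and Gaussian integration by
parts gives `E[y S(X)] = μ θ` with `μ = E f'(Xᵀθ) ≥ μ₀`: the direction can be estimated without
knowing `f`. Without penalty, the quadratic objective is minimized by the empirical mean of the
truncated vectors. Each coordinate of `y S(x)` has second moment at most `V = (σ² + Lf²) M`;
truncation costs a bias `V / τ` and makes a Chernoff bound available at parameter `1 / τ`. The given
`τ` yields `n V / τ² = log(2d/δ) / 3` and `V / τ = O(h)`, so `Δ = θ̂ - μ θ` has norm `O(√d h)`, in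
mean and with probability at least `1 - δ` (`steinEstimator_error`).

The regression step treats the direction `ϑ`, the normalized `θ̂`, as fixed, since the second batch
is independent of it. With `a = ‖Q^{1/2} θ̂‖₁`, one has `θ = κ ϑ - e` for `κ = a / μ` and `e = Δ /
μ`. Split `e = c ϑ + r` with `Q^{1/2} r ⊥ Q^{1/2} ϑ`. The part along `ϑ` is controlled by the kernel
window. The projections on `r` are independent of those on `ϑ`, hence of the kernel weights, so
their weighted absolute average has mean at most `‖Q^{1/2} r‖`, with no loss from a maximum over the
samples. The smoothing bias is therefore `O(h + ‖Δ‖)`.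

Given the design, the noise contributes at most `σ N^{-1/2}`, where `N` counts the points in the
window. Its mean is `O((n q)^{-1/2})`, where `q`, the mass of the window at `t`, is at least of
order `h φ(t)` for the Gaussian density `φ` of the projection. Integrating `(n h φ)^{-1/2}` against
`φ` leaves `(n h)^{-1/2} ∫ √φ = O(h)`, so no lower bound on the density is needed.

The `ℓ¹` normalization only ensures `‖Q^{1/2} ϑ‖₂ ≥ 1/√d`. The growth condition on `d` bounds `d h`,
which keeps the bandwidth comparable to or below the standard deviation of the projection, and also
controls `κ h` and `h log(2d)`. Everything combines into the bound `K (h + ‖Δ‖)` for each fixed `θ̂`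
(`lintegral_predictionError_normalize_le`), which `lintegral_prod_batches` carries to the sample
space. -/

namespace SingleIndex

/-! ### Linear functionals of a Gaussian vector -/

section Gaussian

variable {d : ℕ} {m : EuclideanSpace ℝ (Fin d)} {Q : Matrix (Fin d) (Fin d) ℝ}

lemma inner_eq_dotProduct (u v : EuclideanSpace ℝ (Fin d)) : inner ℝ u v = u.ofLp ⬝ᵥ v.ofLp := by
  rw [PiLp.inner_apply]
  simp [dotProduct, mul_comm]

lemma inner_sqrtMul (hQ : Q.PosSemidef) (u v : EuclideanSpace ℝ (Fin d)) :
    inner ℝ (sqrtMul Q u) (sqrtMul Q v) = u.ofLp ⬝ᵥ (Q *ᵥ v.ofLp) := by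
  have hs : (CFC.sqrt Q)ᵀ = CFC.sqrt Q := by
    have := (CFC.sqrt_nonneg Q).isSelfAdjoint.star_eq
    rwa [Matrix.star_eq_conjTranspose, Matrix.conjTranspose_eq_transpose_of_trivial] at this
  rw [inner_eq_dotProduct]
  simp only [sqrtMul]
  rw [Matrix.dotProduct_mulVec, ← Matrix.mulVec_transpose, hs, Matrix.mulVec_mulVec,
    CFC.sqrt_mul_sqrt_self _ hQ.nonneg, dotProduct_comm, Matrix.dotProduct_mulVec,
    ← Matrix.mulVec_transpose]
  have : Qᵀ = Q := by
    have := hQ.isHermitian.eq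
    rwa [Matrix.conjTranspose_eq_transpose_of_trivial] at this
  rw [this, dotProduct_comm]

lemma sqrtMul_add (u v : EuclideanSpace ℝ (Fin d)) :
    sqrtMul Q (u + v) = sqrtMul Q u + sqrtMul Q v := by
  ext j; simp [sqrtMul, Matrix.mulVec_add]

lemma sqrtMul_smul (c : ℝ) (v : EuclideanSpace ℝ (Fin d)) :
    sqrtMul Q (c • v) = c • sqrtMul Q v := by
  ext j; simp [sqrtMul, Matrix.mulVec_smul]

lemma measurable_sqrtMul : Measurable (sqrtMul Q) := by
  have : Continuous (sqrtMul Q) := by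
    unfold sqrtMul
    fun_prop
  exact this.measurable

lemma covariance_inner (hQ : Q.PosSemidef) (u v : EuclideanSpace ℝ (Fin d)) :
    cov[fun x => inner ℝ u x, fun x => inner ℝ v x; multivariateGaussian m Q] =
      inner ℝ (sqrtMul Q u) (sqrtMul Q v) := by
  rw [inner_sqrtMul hQ, ← covarianceBilin_multivariateGaussian (μ := m) hQ,
    covarianceBilin_apply_eq_cov IsGaussian.memLp_two_id]

lemma map_inner_sub_eq_gaussianReal (hQ : Q.PosSemidef) (v : EuclideanSpace ℝ (Fin d)) :
    (multivariateGaussian m Q).map (fun x => inner ℝ (x - m) v) =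
      gaussianReal 0 (‖sqrtMul Q v‖₊ ^ 2) := by
  have h1 : (multivariateGaussian m Q).map (fun x => inner ℝ v x) =
      gaussianReal (inner ℝ v m) (‖sqrtMul Q v‖₊ ^ 2) := by
    have := IsGaussian.map_eq_gaussianReal (μ := multivariateGaussian m Q) (innerSL ℝ v)
    rw [show (fun x => inner ℝ v x) = ⇑(innerSL ℝ v) from rfl, this,
      ContinuousLinearMap.integral_comp_id_comm IsGaussian.integrable_id]
    congr 1
    · simp
    · rw [← covariance_self (by fun_prop)]
      have h := covariance_inner (m := m) hQ v v
      rw [show (⇑(innerSL ℝ v)) = (fun x => inner ℝ v x) from rfl, h, real_inner_self_eq_norm_sq]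
      ext; simp
  have h2 : (fun x => inner ℝ (x - m) v) =
      (fun t : ℝ => t - inner ℝ v m) ∘ (fun x => inner ℝ v x) := by
    ext x; simp only [Function.comp]; rw [inner_sub_left, real_inner_comm, real_inner_comm m v]
  rw [h2, ← Measure.map_map (by fun_prop) (by fun_prop), h1, gaussianReal_map_sub_const]
  simp

/-- Jointly Gaussian and uncorrelated variables are independent. This is what separates the residual
direction `r` from the kernel weights. -/
lemma indepFun_inner_sub (hQ : Q.PosSemidef) {u v : EuclideanSpace ℝ (Fin d)}
    (huv : inner ℝ (sqrtMul Q u) (sqrtMul Q v) = 0) :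
    IndepFun (fun x => inner ℝ (x - m) u) (fun x => inner ℝ (x - m) v)
      (multivariateGaussian m Q) := by
  have h1 : HasGaussianLaw (fun x => (inner ℝ u x, inner ℝ v x)) (multivariateGaussian m Q) :=
    (IsGaussian.hasGaussianLaw_id (μ := multivariateGaussian m Q)).map_fun
      ((innerSL ℝ u).prod (innerSL ℝ v))
  have h2 := h1.indepFun_of_covariance_eq_zero ((covariance_inner hQ u v).trans huv)
  have h3 := h2.comp (φ := fun t => t - inner ℝ u m) (ψ := fun t => t - inner ℝ v m)
    (by fun_prop) (by fun_prop)
  convert h3 using 1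
  · ext x; simp only [Function.comp]; rw [inner_sub_left, real_inner_comm, real_inner_comm m u]
  · ext x; simp only [Function.comp]; rw [inner_sub_left, real_inner_comm, real_inner_comm m v]

lemma memLp_inner_sub (v : EuclideanSpace ℝ (Fin d)) :
    MemLp (fun x => inner ℝ (x - m) v) 2 (multivariateGaussian m Q) := by
  have h := ((IsGaussian.memLp_two_id (μ := multivariateGaussian m Q)).sub
    (memLp_const m)).inner_const (𝕜 := ℝ) v
  simpa using h

lemma integral_inner_sub (v : EuclideanSpace ℝ (Fin d)) (hQ : Q.PosSemidef) :
    ∫ x, inner ℝ (x - m) v ∂multivariateGaussian m Q = 0 := by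
  have h := integral_map (μ := multivariateGaussian m Q) (φ := fun x => inner ℝ (x - m) v)
    (by fun_prop) (f := fun t : ℝ => t) (by fun_prop)
  rw [map_inner_sub_eq_gaussianReal hQ, integral_id_gaussianReal] at h
  exact h.symm

lemma integral_inner_sub_sq (hQ : Q.PosSemidef) (v : EuclideanSpace ℝ (Fin d)) :
    ∫ x, (inner ℝ (x - m) v) ^ 2 ∂multivariateGaussian m Q = ‖sqrtMul Q v‖ ^ 2 := by
  have h := integral_map (μ := multivariateGaussian m Q) (φ := fun x => inner ℝ (x - m) v)
    (by fun_prop) (f := fun t : ℝ => t ^ 2) (by fun_prop)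
  rw [map_inner_sub_eq_gaussianReal hQ] at h
  rw [← h]
  have h2 := variance_fun_id_gaussianReal (μ := 0) (v := ‖sqrtMul Q v‖₊ ^ 2)
  rw [variance_eq_integral (by fun_prop)] at h2
  simpa using h2

lemma lintegral_abs_inner_sub_le (hQ : Q.PosSemidef) (v : EuclideanSpace ℝ (Fin d)) :
    ∫⁻ x, ENNReal.ofReal |inner ℝ (x - m) v| ∂multivariateGaussian m Q ≤
      ENNReal.ofReal ‖sqrtMul Q v‖ := by
  have hm := memLp_inner_sub (m := m) (Q := Q) v
  rw [← ofReal_integral_eq_lintegral_ofReal (hm.integrable (by norm_num)).abs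
    (ae_of_all _ fun _ => abs_nonneg _)]
  refine ENNReal.ofReal_le_ofReal (abs_le_of_sq_le_sq' ?_ (norm_nonneg _)).2
  rw [← integral_inner_sub_sq (m := m) hQ]
  -- Nonnegativity of the variance of the absolute value is Jensen's inequality `(E|Z|)² ≤ E Z²`.
  have h := variance_nonneg (fun x => |inner ℝ (x - m) v|) (multivariateGaussian m Q)
  rw [variance_eq_sub (X := fun x => |inner ℝ (x - m) v|) hm.abs] at h
  simpa using h

end Gaussian

/-! ### Stein's identity and the Gaussian score -/

lemma hasDerivAt_gaussianPDFReal_zero (v : NNReal) (t : ℝ) :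
    HasDerivAt (gaussianPDFReal 0 v) (-(t / v) * gaussianPDFReal 0 v t) t := by
  have h : HasDerivAt (fun x : ℝ => -(x - 0) ^ 2 / (2 * v)) (-(t / v)) t := by
    have h1 := (((hasDerivAt_id t).sub_const 0).pow 2).neg.div_const (2 * (v : ℝ))
    refine h1.congr_deriv ?_
    simp only [id]
    rcases eq_or_ne (v : ℝ) 0 with hv | hv
    · simp [hv]
    · field_simp
      simp [mul_comm]
  have h2 := h.exp.const_mul (√(2 * Real.pi * v))⁻¹
  rw [gaussianPDFReal_def]
  refine h2.congr_deriv ?_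
  ring

/-- **Stein's identity** on the real line. -/
lemma integral_mul_id_gaussianReal (v : NNReal) {g : ℝ → ℝ} (hg : ContDiff ℝ 1 g) {K K' : ℝ}
    (hK : ∀ t, |g t| ≤ K) (hK' : ∀ t, |deriv g t| ≤ K') :
    ∫ t, g t * t ∂gaussianReal 0 v = v * ∫ t, deriv g t ∂gaussianReal 0 v := by
  rcases eq_or_ne v 0 with rfl | hv
  · simp
  have hv' : (0 : ℝ) < v := by positivity
  have hφ := integrable_gaussianPDFReal 0 v
  have hφ' : Integrable fun t => -(t / v) * gaussianPDFReal 0 v t := by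
    have h := (integrable_mul_exp_neg_mul_sq (b := (2 * (v : ℝ))⁻¹) (by positivity)).const_mul
      (-(√(2 * Real.pi * v))⁻¹ / v)
    refine h.congr (ae_of_all _ fun t => ?_)
    simp only [gaussianPDFReal]
    rw [show -(t - 0) ^ 2 / (2 * (v : ℝ)) = -(2 * (v : ℝ))⁻¹ * t ^ 2 by simp; ring]
    ring
  have hcd : Continuous (deriv g) := hg.continuous_deriv le_rfl
  -- Since `φ' = -(t/v) φ`, integration by parts moves the derivative onto `g`; there are no
  -- boundary terms because all the products involved are integrable.
  have key := integral_mul_deriv_eq_deriv_mul_of_integrable (u := g) (v := gaussianPDFReal 0 v)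
    (u' := deriv g) (v' := fun t => -(t / v) * gaussianPDFReal 0 v t)
    (fun t _ => (hg.differentiable one_ne_zero t).hasDerivAt)
    (fun t _ => hasDerivAt_gaussianPDFReal_zero v t)
    (hφ'.bdd_mul hg.continuous.aestronglyMeasurable (ae_of_all _ hK))
    (hφ.bdd_mul hcd.aestronglyMeasurable (ae_of_all _ hK'))
    (hφ.bdd_mul hg.continuous.aestronglyMeasurable (ae_of_all _ hK))
  rw [integral_gaussianReal_eq_integral_smul hv, integral_gaussianReal_eq_integral_smul hv]
  have h1 : ∫ x, gaussianPDFReal 0 v x • (g x * x) =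
      ∫ x, -v * (g x * (-(x / v) * gaussianPDFReal 0 v x)) := by
    congr 1; ext x; simp only [smul_eq_mul]; field_simp
  rw [h1, integral_const_mul, key]
  simp [mul_comm]

section

variable {d : ℕ} {m : EuclideanSpace ℝ (Fin d)} {Q : Matrix (Fin d) (Fin d) ℝ}

/-- **Stein's identity** for two linear functionals of a Gaussian vector. -/
lemma integral_comp_inner_mul_inner (hQ : Q.PosSemidef) {f : ℝ → ℝ} (hf : ContDiff ℝ 1 f)
    {K K' : ℝ} (hK : ∀ t, |f t| ≤ K) (hK' : ∀ t, |deriv f t| ≤ K')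
    (θ v : EuclideanSpace ℝ (Fin d)) (hθ : sqrtMul Q θ ≠ 0) :
    ∫ x, f (inner ℝ x θ) * inner ℝ (x - m) v ∂multivariateGaussian m Q =
      inner ℝ (sqrtMul Q θ) (sqrtMul Q v) *
        ∫ x, deriv f (inner ℝ x θ) ∂multivariateGaussian m Q := by
  set D := multivariateGaussian m Q
  set g : ℝ → ℝ := fun t => f (t + inner ℝ m θ) with hgdef
  have hg : ContDiff ℝ 1 g := hf.comp (contDiff_id.add contDiff_const)
  have hgx : ∀ x, f (inner ℝ x θ) = g (inner ℝ (x - m) θ) := fun x => by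
    simp [hgdef, inner_sub_left]
  have hdg : ∀ t, deriv g t = deriv f (t + inner ℝ m θ) := fun t => deriv_comp_add_const _ _ _
  have hdgx : ∀ x, deriv f (inner ℝ x θ) = deriv g (inner ℝ (x - m) θ) := fun x => by
    simp [hdg, inner_sub_left]
  simp_rw [hgx, hdgx]
  set s := ‖sqrtMul Q θ‖
  have hs : s ^ 2 ≠ 0 := by simpa [s] using hθ
  -- Project `v` on `θ` in the inner product of `Q`. The remainder `r` gives a centred variable
  -- independent of the projection on `θ`, so only the component along `θ` contributes, and there
  -- the one-dimensional identity applies.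
  set c := inner ℝ (sqrtMul Q θ) (sqrtMul Q v) / s ^ 2 with hc
  set r := v - c • θ with hr
  have hvr : v = c • θ + r := by simp [hr]
  have horth : inner ℝ (sqrtMul Q θ) (sqrtMul Q r) = 0 := by
    have h1 : sqrtMul Q r = sqrtMul Q v - c • sqrtMul Q θ := by
      rw [eq_sub_iff_add_eq, ← sqrtMul_smul, ← sqrtMul_add, add_comm, ← hvr]
    rw [h1, inner_sub_right, inner_smul_right, real_inner_self_eq_norm_sq, hc,
      div_mul_cancel₀ _ hs, sub_self]
  have hind := indepFun_inner_sub (m := m) hQ horth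
  have hgm : Measurable g := hg.continuous.measurable
  have hgb : ∀ t, ‖g t‖ ≤ K := fun t => hK _
  have hmeas : Measurable fun x : EuclideanSpace ℝ (Fin d) => (inner ℝ (x - m) θ : ℝ) := by
    fun_prop
  have hI : ∀ w : EuclideanSpace ℝ (Fin d), Integrable
      (fun x => g (inner ℝ (x - m) θ) * inner ℝ (x - m) w) D := fun w =>
    ((memLp_inner_sub w).integrable (by norm_num)).bdd_mul
      (hgm.comp hmeas).aestronglyMeasurable (ae_of_all _ fun x => hgb _)
  have h0 : ∫ x, g (inner ℝ (x - m) θ) * inner ℝ (x - m) r ∂D = 0 := by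
    have h2 := (hind.comp (φ := g) (ψ := id) hgm measurable_id).integral_fun_mul_eq_mul_integral
      (by fun_prop) (by fun_prop)
    simp only [Function.comp, id] at h2
    rw [h2, integral_inner_sub r hQ, mul_zero]
  have h1 : ∫ x, g (inner ℝ (x - m) θ) * inner ℝ (x - m) θ ∂D =
      s ^ 2 * ∫ x, deriv g (inner ℝ (x - m) θ) ∂D := by
    have e1 := integral_map (μ := D) hmeas.aemeasurable (f := fun t : ℝ => g t * t)
      (by fun_prop)
    have e2 := integral_map (μ := D) hmeas.aemeasurable (f := fun t : ℝ => deriv g t)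
      (measurable_deriv g).aestronglyMeasurable
    rw [← e1, ← e2, map_inner_sub_eq_gaussianReal hQ,
      integral_mul_id_gaussianReal _ hg (fun t => hK _) (K' := K') (fun t => by
        rw [hdg]; exact hK' _)]
    simp [s]
  have h3 : ∀ x, g (inner ℝ (x - m) θ) * inner ℝ (x - m) v =
      c * (g (inner ℝ (x - m) θ) * inner ℝ (x - m) θ) +
        g (inner ℝ (x - m) θ) * inner ℝ (x - m) r := fun x => by
    conv_lhs => rw [hvr, inner_add_right, inner_smul_right]
    ring
  simp_rw [h3]
  rw [integral_add ((hI θ).const_mul c) (hI r), integral_const_mul, h0, h1, hc,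
    ← mul_assoc, div_mul_cancel₀ _ hs, add_zero]

lemma score_gaussianDensity (hQ : Q.PosDef) (x : EuclideanSpace ℝ (Fin d)) :
    score (gaussianDensity m Q) x = WithLp.toLp 2 (Q⁻¹ *ᵥ (x - m).ofLp) := by
  set T := Matrix.toEuclideanCLM (n := Fin d) (𝕜 := ℝ) Q⁻¹ with hT
  have hsym : (Q⁻¹)ᵀ = Q⁻¹ := by
    have := hQ.inv.isHermitian.eq
    rwa [Matrix.conjTranspose_eq_transpose_of_trivial] at this
  have hTx : ∀ z, T z = WithLp.toLp 2 (Q⁻¹ *ᵥ z.ofLp) := fun z => by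
    ext j; simp [hT]
  have hTs : ∀ z w, inner ℝ z (T w) = inner ℝ (T z) w := fun z w => by
    rw [inner_eq_dotProduct, inner_eq_dotProduct, hTx, hTx]
    simp only
    rw [Matrix.dotProduct_mulVec, ← Matrix.mulVec_transpose, hsym]
  set c := (2 * Real.pi) ^ (-(d : ℝ) / 2) * (Real.sqrt Q.det)⁻¹
  have hdens : gaussianDensity m Q =
      fun x => c * Real.exp (-(inner ℝ (x - m) (T (x - m))) / 2) := by
    ext x
    rw [inner_eq_dotProduct, hTx]
    rfl
  have hpos : 0 < gaussianDensity m Q x := by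
    have : 0 < Q.det := hQ.det_pos
    unfold gaussianDensity
    positivity
  have h1 : HasFDerivAt (fun y : EuclideanSpace ℝ (Fin d) => y - m)
      (ContinuousLinearMap.id ℝ (EuclideanSpace ℝ (Fin d))) x := (hasFDerivAt_id x).sub_const m
  have h2 := h1.inner ℝ (T.hasFDerivAt.comp x h1)
  have h3 := (((h2.neg.const_mul (1 / 2 : ℝ))).exp.const_mul c)
  have hg : HasGradientAt (gaussianDensity m Q) (-(gaussianDensity m Q x • T (x - m))) x := by
    rw [hasGradientAt_iff_hasFDerivAt]
    have e : gaussianDensity m Q = fun y => c * Real.exp ((1 / 2 : ℝ) *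
        (fun t => -inner ℝ (t - m) ((T ∘ fun y => y - m) t)) y) := by
      rw [hdens]; ext y; simp only [Function.comp]; ring_nf
    have e2 : gaussianDensity m Q x = c * Real.exp ((1 / 2 : ℝ) *
        -inner ℝ (x - m) (T (x - m))) := by rw [e]; rfl
    rw [e2]
    rw [e]
    refine h3.congr_fderiv ?_
    ext w
    simp only [Function.comp, Pi.neg_apply]
    generalize x - m = z
    simp [hTs]
    rw [real_inner_comm w (T z), hTs w z]
    ring
  rw [score, hg.gradient, smul_neg, neg_neg, inv_smul_smul₀ hpos.ne', hTx]

/-- The vector representing the `j`-th coordinate of the score of `N(m, Q)`. -/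
noncomputable def scoreVec (Q : Matrix (Fin d) (Fin d) ℝ) (j : Fin d) : EuclideanSpace ℝ (Fin d) :=
  WithLp.toLp 2 (Q⁻¹ *ᵥ Pi.single j 1)

lemma score_apply (hQ : Q.PosDef) (x : EuclideanSpace ℝ (Fin d)) (j : Fin d) :
    score (gaussianDensity m Q) x j = inner ℝ (x - m) (scoreVec Q j) := by
  have hsym : (Q⁻¹)ᵀ = Q⁻¹ := by
    have := hQ.inv.isHermitian.eq
    rwa [Matrix.conjTranspose_eq_transpose_of_trivial] at this
  rw [score_gaussianDensity hQ, inner_eq_dotProduct, scoreVec]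
  simp only
  rw [Matrix.dotProduct_mulVec, ← Matrix.mulVec_transpose, hsym]
  simp

/-- The factors `Q` and `Q⁻¹` cancel. Stein's identity along `scoreVec Q j` thus returns `θ j` times
the mean of `f'`. -/
lemma inner_sqrtMul_scoreVec (hQ : Q.PosDef) (θ : EuclideanSpace ℝ (Fin d)) (j : Fin d) :
    inner ℝ (sqrtMul Q θ) (sqrtMul Q (scoreVec Q j)) = θ j := by
  rw [inner_sqrtMul hQ.posSemidef, scoreVec]
  simp only
  rw [Matrix.mulVec_mulVec, Matrix.mul_nonsing_inv _ (by simpa using hQ.det_pos.ne'),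
    Matrix.one_mulVec]
  simp

end

/-! ### Mass of a window and Gaussian integrals -/

/-- Mass that the centred Gaussian distribution with variance `v` gives to the window of
half-width `h` around `p`. -/
noncomputable def windowMass (v : NNReal) (h p : ℝ) : ℝ := (gaussianReal 0 v).real {t | |p - t| ≤ h}

lemma gaussianPDFReal_zero_le_of_sq_le {v : NNReal} (hv : v ≠ 0) {h p t : ℝ}
    (ht : t ^ 2 ≤ p ^ 2 + h ^ 2) :
    Real.exp (-h ^ 2 / (2 * v)) * gaussianPDFReal 0 v p ≤ gaussianPDFReal 0 v t := by
  have hv' : (0 : ℝ) < v := by positivity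
  simp only [gaussianPDFReal]
  rw [mul_left_comm, ← Real.exp_add]
  gcongr
  rw [← add_div]
  gcongr
  nlinarith

/-- Only the half of the window on the side of the origin is kept: there `t² ≤ p² + h²`, even past
the origin, so the density loses at most the factor `exp(-h²/(2v))` compared with `p`. -/
lemma le_windowMass {v : NNReal} (hv : v ≠ 0) {h : ℝ} (hh : 0 < h) (p : ℝ) :
    h * (Real.exp (-h ^ 2 / (2 * v)) * gaussianPDFReal 0 v p) ≤ windowMass v h p := by
  obtain ⟨a, ha⟩ : ∃ a : ℝ, ∀ t ∈ Set.Icc a (a + h), |p - t| ≤ h ∧ t ^ 2 ≤ p ^ 2 + h ^ 2 := by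
    rcases le_total 0 p with hp | hp
    · refine ⟨p - h, fun t ht => ⟨abs_le.2 ⟨by linarith [ht.2], by linarith [ht.1]⟩, ?_⟩⟩
      have h1 : t ≤ p := by linarith [ht.2]
      rcases le_total 0 t with h0 | h0
      · nlinarith
      · nlinarith [ht.1]
    · refine ⟨p, fun t ht => ⟨abs_le.2 ⟨by linarith [ht.2], by linarith [ht.1]⟩, ?_⟩⟩
      rcases le_total 0 t with h0 | h0
      · nlinarith [ht.2]
      · nlinarith [ht.1]
  have hsub : Set.Icc a (a + h) ⊆ {t | |p - t| ≤ h} := fun t ht => (ha t ht).1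
  have hI := integrable_gaussianPDFReal 0 v
  calc h * (Real.exp (-h ^ 2 / (2 * v)) * gaussianPDFReal 0 v p)
      = ∫ t in Set.Icc a (a + h), Real.exp (-h ^ 2 / (2 * v)) * gaussianPDFReal 0 v p := by
        simp [measureReal_def, hh.le]
    _ ≤ ∫ t in Set.Icc a (a + h), gaussianPDFReal 0 v t := by
        refine setIntegral_mono_on (integrableOn_const (by simp)) hI.integrableOn measurableSet_Icc
          fun t ht => gaussianPDFReal_zero_le_of_sq_le hv (ha t ht).2
    _ = (gaussianReal 0 v).real (Set.Icc a (a + h)) := by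
        rw [measureReal_def, gaussianReal_apply_eq_integral 0 hv, ENNReal.toReal_ofReal]
        exact integral_nonneg fun t => gaussianPDFReal_nonneg _ _ _
    _ ≤ windowMass v h p := measureReal_mono hsub

/-- For `v = 0` the law is the Dirac mass at `0`, which a window around `0` contains. This covers a
vanishing estimated direction. -/
lemma windowMass_pos (v : NNReal) {h : ℝ} (hh : 0 < h) (p : ℝ) (hp : v = 0 → p = 0) :
    0 < windowMass v h p := by
  rcases eq_or_ne v 0 with rfl | hv
  · simp [windowMass, hp rfl, hh.le, measureReal_def]
  · refine lt_of_lt_of_le ?_ (le_windowMass hv hh p)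
    have := gaussianPDFReal_pos 0 v p hv
    positivity

lemma measurable_windowMass (v : NNReal) (h : ℝ) : Measurable (windowMass v h) := by
  have h1 : MeasurableSet {z : ℝ × ℝ | |z.1 - z.2| ≤ h} :=
    measurableSet_le (by fun_prop) (by fun_prop)
  exact (measurable_measure_prodMk_left (ν := gaussianReal 0 v) h1).ennreal_toReal

/-- The square root of the density is again a Gaussian function, of integral `(8πv)^{1/4}`, which is
below `3` when `v ≤ 1`. -/
lemma integral_sqrt_gaussianPDFReal_le {v : NNReal} (hv : v ≠ 0) (hv1 : v ≤ 1) :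
    Integrable (fun p => √(gaussianPDFReal 0 v p)) ∧ ∫ p, √(gaussianPDFReal 0 v p) ≤ 3 := by
  have hv' : (0 : ℝ) < v := by positivity
  have hv1' : (v : ℝ) ≤ 1 := by exact_mod_cast hv1
  have h1 : ∀ p, √(gaussianPDFReal 0 v p) =
      √((√(2 * Real.pi * v))⁻¹) * Real.exp (-(1 / (4 * v)) * p ^ 2) := fun p => by
    simp only [gaussianPDFReal]
    rw [Real.sqrt_mul (by positivity)]
    congr 1
    rw [Real.sqrt_eq_iff_mul_self_eq (by positivity) (by positivity), ← Real.exp_add]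
    congr 1
    field_simp
    ring
  simp_rw [h1]
  refine ⟨(integrable_exp_neg_mul_sq (by positivity)).const_mul _, ?_⟩
  rw [integral_const_mul, integral_gaussian, ← Real.sqrt_mul (by positivity)]
  refine Real.sqrt_le_iff.2 ⟨by norm_num, ?_⟩
  rw [inv_mul_le_iff₀ (by positivity)]
  have h3 := Real.pi_gt_three
  have h4 := Real.pi_le_four
  have h5 : Real.pi / (1 / (4 * v)) = 4 * Real.pi * v := by field_simp
  rw [h5]
  have h6 : 4 * Real.pi * v ≤ √(2 * Real.pi * v) * √ (8 * Real.pi * v) := by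
    rw [← Real.sqrt_mul (by positivity)]
    exact Real.le_sqrt_of_sq_le (by nlinarith)
  refine h6.trans ?_
  gcongr
  refine Real.sqrt_le_iff.2 ⟨by norm_num, ?_⟩
  nlinarith

/-- By `le_windowMass` the integrand is at most a multiple of `φ^{-1/2}`; against the density `φ` it
becomes `√φ`, which is integrable. The exponential is the inverse square root of the loss in
`le_windowMass`. -/
lemma lintegral_inv_sqrt_windowMass_le {v : NNReal} (hv : v ≠ 0) (hv1 : v ≤ 1) {h N : ℝ}
    (hh : 0 < h) (hN : 0 < N) :
    ∫⁻ p, ENNReal.ofReal (1 / √(N * windowMass v h p)) ∂gaussianReal 0 v ≤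
      ENNReal.ofReal (3 * Real.exp (h ^ 2 / (4 * v)) / √(N * h)) := by
  obtain ⟨hint, hle⟩ := integral_sqrt_gaussianPDFReal_le hv hv1
  have hm := measurable_windowMass v h
  rw [gaussianReal_of_var_ne_zero 0 hv,
    lintegral_withDensity_eq_lintegral_mul _ (measurable_gaussianPDF 0 v) (by fun_prop)]
  set c := Real.exp (h ^ 2 / (4 * v)) / √(N * h)
  have hb : ∀ p, (gaussianPDF 0 v * fun p => ENNReal.ofReal (1 / √(N * windowMass v h p))) p ≤
      ENNReal.ofReal (c * √(gaussianPDFReal 0 v p)) := fun p => by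
    simp only [Pi.mul_apply, gaussianPDF]
    rw [← ENNReal.ofReal_mul (gaussianPDFReal_nonneg _ _ _)]
    refine ENNReal.ofReal_le_ofReal ?_
    have hφ := gaussianPDFReal_pos 0 v p hv
    set φ := gaussianPDFReal 0 v p
    have h1 : N * h * Real.exp (-h ^ 2 / (2 * v)) * φ ≤ N * windowMass v h p := by
      have := le_windowMass hv hh p
      calc _ = N * (h * (Real.exp (-h ^ 2 / (2 * v)) * φ)) := by ring
        _ ≤ _ := by gcongr
    have h2 : √(Real.exp (-h ^ 2 / (2 * v))) = (Real.exp (h ^ 2 / (4 * v)))⁻¹ := by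
      rw [Real.sqrt_eq_iff_mul_self_eq (by positivity) (by positivity), ← Real.exp_neg,
        ← Real.exp_add]
      congr 1
      field_simp
      ring
    calc φ * (1 / √(N * windowMass v h p))
        ≤ φ * (1 / √(N * h * Real.exp (-h ^ 2 / (2 * v)) * φ)) := by gcongr
      _ = c * √φ := by
        rw [Real.sqrt_mul (by positivity), Real.sqrt_mul (by positivity), h2]
        have h3 : φ = √φ * √φ := (Real.mul_self_sqrt hφ.le).symm
        have h4 : 0 < √φ := Real.sqrt_pos.2 hφ
        have h5 : 0 < √(N * h) := Real.sqrt_pos.2 (by positivity)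
        simp only [c]
        conv_lhs => enter [1]; rw [h3]
        field_simp
  refine (lintegral_mono hb).trans ?_
  rw [← ofReal_integral_eq_lintegral_ofReal (hint.const_mul c)
    (ae_of_all _ fun p => by positivity), integral_const_mul]
  refine ENNReal.ofReal_le_ofReal ?_
  calc c * _ ≤ c * 3 := by gcongr
    _ = _ := by simp only [c]; ring

/-- Chernoff's bound at parameter `W` on each side: the exponent is `-W² + v W²/2 ≤ -W²/2`. -/
lemma gaussianReal_abs_gt_le {v : NNReal} (hv1 : v ≤ 1) {W : ℝ} (hW : 0 ≤ W) :
    (gaussianReal 0 v) {t | W < |t|} ≤ ENNReal.ofReal (2 * Real.exp (-W ^ 2 / 2)) := by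
  have hv1' : (v : ℝ) ≤ 1 := by exact_mod_cast hv1
  have h1 : ∀ c : ℝ, c = 1 ∨ c = -1 → (gaussianReal 0 v).real {t | W ≤ c * t} ≤
      Real.exp (-W ^ 2 / 2) := fun c hc => by
    have hlaw : (gaussianReal 0 v).map (fun t => c * t) = gaussianReal 0 v := by
      rw [gaussianReal_map_const_mul]
      congr 1
      · simp
      · ext; rcases hc with rfl | rfl <;> simp
    have hint : Integrable (fun t => Real.exp (W * (c * t))) (gaussianReal 0 v) := by
      have := integrable_exp_mul_gaussianReal (μ := 0) (v := v) (W * c)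
      simpa [mul_assoc] using this
    refine (measure_ge_le_exp_mul_mgf W hW hint).trans ?_
    rw [mgf_gaussianReal hlaw, ← Real.exp_add]
    refine Real.exp_le_exp.2 ?_
    nlinarith [mul_nonneg (sq_nonneg W) (sub_nonneg.2 hv1')]
  have h2 : {t : ℝ | W < |t|} ⊆ {t | W ≤ 1 * t} ∪ {t | W ≤ -1 * t} := fun t ht => by
    rcases lt_abs.1 (show W < |t| from ht) with h | h
    · left; simpa using h.le
    · right; simpa using h.le
  refine (measure_mono h2).trans ((measure_union_le _ _).trans ?_)
  rw [two_mul, ENNReal.ofReal_add (by positivity) (by positivity)]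
  refine add_le_add ?_ ?_
  · exact (ENNReal.le_ofReal_iff_toReal_le (measure_ne_top _ _) (by positivity)).2 (h1 1 (.inl rfl))
  · exact (ENNReal.le_ofReal_iff_toReal_le (measure_ne_top _ _) (by positivity)).2
      (h1 (-1) (.inr rfl))

/-! ### Kernel weights and counts -/

section Weights

variable {n : ℕ}

/-- Number of the points `p i` within distance `h` of `t`. -/
noncomputable def windowCount (h t : ℝ) (p : Fin n → ℝ) : ℝ := ∑ i, if |t - p i| ≤ h then 1 else 0

/-- The weights of the kernel regression estimator at `t` with design points `p i`. -/
noncomputable def kernelWeight (h t : ℝ) (p : Fin n → ℝ) (i : Fin n) : ℝ :=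
  (if |t - p i| ≤ h then 1 else 0) / windowCount h t p

lemma windowCount_nonneg (h t : ℝ) (p : Fin n → ℝ) : 0 ≤ windowCount h t p :=
  Finset.sum_nonneg fun i _ => by split_ifs <;> norm_num

lemma kernelWeight_nonneg (h t : ℝ) (p : Fin n → ℝ) (i : Fin n) : 0 ≤ kernelWeight h t p i :=
  div_nonneg (by split_ifs <;> norm_num) (windowCount_nonneg h t p)

lemma sum_kernelWeight {h t : ℝ} {p : Fin n → ℝ} (hc : windowCount h t p ≠ 0) :
    ∑ i, kernelWeight h t p i = 1 := by
  simp only [kernelWeight]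
  rw [← Finset.sum_div]
  exact div_self hc

lemma kernelWeight_eq_zero {h t : ℝ} {p : Fin n → ℝ} (hc : windowCount h t p = 0) (i : Fin n) :
    kernelWeight h t p i = 0 := by simp [kernelWeight, hc]

lemma sum_kernelWeight_le_one (h t : ℝ) (p : Fin n → ℝ) : ∑ i, kernelWeight h t p i ≤ 1 := by
  by_cases hc : windowCount h t p = 0
  · simp [kernelWeight_eq_zero hc]
  · exact (sum_kernelWeight hc).le

/-- All nonzero weights equal the inverse count, so this is the variance factor of the averaged
noise. For an empty window both sides are `0`. -/
lemma sum_kernelWeight_sq (h t : ℝ) (p : Fin n → ℝ) :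
    ∑ i, kernelWeight h t p i ^ 2 = 1 / windowCount h t p := by
  by_cases hc : windowCount h t p = 0
  · simp [kernelWeight_eq_zero hc, hc]
  have h1 : ∀ i, kernelWeight h t p i ^ 2 = kernelWeight h t p i / windowCount h t p := fun i => by
    simp only [kernelWeight]; split_ifs <;> field_simp
    simp
  simp_rw [h1]
  rw [← Finset.sum_div, sum_kernelWeight hc]

lemma kernelWeight_mul_le {h t : ℝ} {p : Fin n → ℝ} {i : Fin n} {a b : ℝ}
    (hab : |t - p i| ≤ h → a ≤ b) : kernelWeight h t p i * a ≤ kernelWeight h t p i * b := by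
  by_cases hi : |t - p i| ≤ h
  · exact mul_le_mul_of_nonneg_left (hab hi) (kernelWeight_nonneg h t p i)
  · simp [kernelWeight, hi]

/-- Centring at `m` makes the projections centred Gaussian, and the factor `1 / h` cancels. For an
empty window the vanishing weights agree with the convention `0 / 0 = 0`. -/
lemma kernelRegression_eq {d : ℕ} (m ϑ : EuclideanSpace ℝ (Fin d)) {h : ℝ} (hh : 0 < h) (W : ℝ)
    (x : Fin n → EuclideanSpace ℝ (Fin d)) (y : Fin n → ℝ) (u : EuclideanSpace ℝ (Fin d)) :
    kernelRegression m h W ϑ x y (inner ℝ u ϑ) =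
      if |inner ℝ (u - m) ϑ| ≤ W then
        ∑ i, kernelWeight h (inner ℝ (u - m) ϑ) (fun i => inner ℝ (x i - m) ϑ) i * y i else 0 := by
  have h1 : ∀ i, uniformKernel h (inner ℝ u ϑ - inner ℝ (x i) ϑ) =
      (if |inner ℝ (u - m) ϑ - inner ℝ (x i - m) ϑ| ≤ h then 1 else 0) * h⁻¹ := fun i => by
    have : inner ℝ (u - m) ϑ - inner ℝ (x i - m) ϑ = inner ℝ u ϑ - inner ℝ (x i) ϑ := by
      simp [inner_sub_left]
    rw [this]
    simp [uniformKernel]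
  simp only [kernelRegression, h1]
  rw [← inner_sub_left u m ϑ]
  refine if_congr Iff.rfl ?_ rfl
  simp_rw [← mul_assoc]
  rw [← Finset.sum_mul, ← Finset.sum_mul, mul_div_mul_right _ _ (inv_ne_zero hh.ne'),
    Finset.sum_div]
  refine Finset.sum_congr rfl fun i _ => ?_
  simp only [kernelWeight, windowCount]
  ring

/-- `ψ(N) = N^{-1/2}` for `N > 0` and `ψ(0) = 1`. -/
noncomputable def invSqrtOrOne (N : ℝ) : ℝ := if N = 0 then 1 else 1 / √N

/-- A majorant quadratic in `N`, so that the mean and variance of the count suffice. If `N ≥ a/4`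
the first term is enough. Otherwise the left side is at most `1`: the first term handles `a ≤ 1`,
and for `a > 1` the deviation `(N - a)² ≥ (9/16) a²` makes the second term at least `1`. -/
lemma invSqrtOrOne_le {N a : ℝ} (hN : N = 0 ∨ 1 ≤ N) (ha : 0 < a) :
    invSqrtOrOne N ≤ 2 / √a + 2 / (a * √a) * (N - a) ^ 2 := by
  have hs : 0 < √a := Real.sqrt_pos.2 ha
  have hsa : √a * √a = a := Real.mul_self_sqrt ha.le
  have h1 : invSqrtOrOne N ≤ 1 := by
    rcases hN with rfl | hN
    · simp [invSqrtOrOne]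
    · rw [invSqrtOrOne, if_neg (by linarith), div_le_one (by positivity)]
      exact Real.one_le_sqrt.2 hN
  rcases le_or_gt (a / 4) N with h2 | h2
  · have hN0 : 0 < N := by linarith
    rw [invSqrtOrOne, if_neg hN0.ne']
    have : 1 / √N ≤ 2 / √a := by
      rw [div_le_div_iff₀ (Real.sqrt_pos.2 hN0) hs, one_mul]
      refine Real.sqrt_le_iff.2 ⟨by positivity, ?_⟩
      rw [mul_pow, Real.sq_sqrt hN0.le]; linarith
    have : 0 ≤ 2 / (a * √a) * (N - a) ^ 2 := by positivity
    linarith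
  · refine h1.trans ?_
    rcases le_or_gt a 1 with h3 | h3
    · have : √a ≤ 1 := Real.sqrt_le_one.2 h3
      have : 2 ≤ 2 / √a := by rw [le_div_iff₀ hs]; linarith
      have : 0 ≤ 2 / (a * √a) * (N - a) ^ 2 := by positivity
      linarith
    · have h4 : 1 ≤ √a := Real.one_le_sqrt.2 h3.le
      have h5 : (9 / 16) * a ^ 2 ≤ (N - a) ^ 2 := by nlinarith
      have h6 : 2 / (a * √a) * ((9 / 16) * a ^ 2) ≤ 2 / (a * √a) * (N - a) ^ 2 := by gcongr
      have h7 : 2 / (a * √a) * ((9 / 16) * a ^ 2) = (9 / 8) * √a := by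
        field_simp
        nlinarith
      have : 0 ≤ 2 / √a := by positivity
      linarith

end Weights

/-! ### Moments and independence for product measures -/

section Product

variable {n : ℕ}

lemma lintegral_ofReal_eq_ofReal_integral {α : Type*} [MeasurableSpace α] {μ : Measure α}
    {g : α → ℝ} (hg : Integrable g μ) (h0 : 0 ≤ g) :
    ∫⁻ a, ENNReal.ofReal (g a) ∂μ = ENNReal.ofReal (∫ a, g a ∂μ) :=
  (ofReal_integral_eq_lintegral_ofReal hg (ae_of_all _ h0)).symm

lemma lintegral_ofReal_abs_le {α : Type*} [MeasurableSpace α] {μ : Measure α}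
    [IsProbabilityMeasure μ] {g : α → ℝ} (hg : MemLp g 2 μ) {b : ℝ} (hb : 0 ≤ b)
    (h : ∫ a, g a ^ 2 ∂μ ≤ b ^ 2) :
    ∫⁻ a, ENNReal.ofReal |g a| ∂μ ≤ ENNReal.ofReal b := by
  rw [lintegral_ofReal_eq_ofReal_integral (hg.integrable (by norm_num)).abs
    (fun _ => abs_nonneg _)]
  refine ENNReal.ofReal_le_ofReal (abs_le_of_sq_le_sq' ?_ hb).2
  refine le_trans ?_ h
  have h := variance_nonneg (fun x => |g x|) μ
  rw [variance_eq_sub (X := fun x => |g x|) hg.abs] at h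
  simpa using h

lemma memLp_linear_pi (ν : Fin n → Measure ℝ) [∀ i, IsProbabilityMeasure (ν i)]
    (h2 : ∀ i, MemLp id 2 (ν i)) (w : Fin n → ℝ) :
    MemLp (fun t : Fin n → ℝ => ∑ i, w i * t i) 2 (Measure.pi ν) :=
  memLp_finsetSum _ fun i _ =>
    ((h2 i).comp_measurePreserving (measurePreserving_eval ν i)).const_mul (w i)

/-- First absolute moment of a weighted sum of independent centred noises. -/
lemma lintegral_abs_sum_noise_le (ν : Fin n → Measure ℝ) [∀ i, IsProbabilityMeasure (ν i)]
    (h2 : ∀ i, MemLp id 2 (ν i)) (h0 : ∀ i, ∫ t, t ∂ν i = 0) {σ : ℝ} (hσ : 0 ≤ σ)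
    (hv : ∀ i, variance id (ν i) ≤ σ ^ 2) (w : Fin n → ℝ) :
    ∫⁻ t, ENNReal.ofReal |∑ i, w i * t i| ∂Measure.pi ν ≤
      ENNReal.ofReal (σ * √(∑ i, w i ^ 2)) := by
  have hm := memLp_linear_pi ν h2 w
  refine lintegral_ofReal_abs_le hm (by positivity) ?_
  have hvar := variance_sum_pi (μ := ν) (X := fun i t => w i * t) (fun i => (h2 i).const_mul (w i))
  have hmean : ∫ t, ∑ i, w i * t i ∂Measure.pi ν = 0 := by
    rw [integral_finsetSum]
    · refine Finset.sum_eq_zero fun i _ => ?_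
      rw [integral_const_mul, integral_comp_eval (μ := ν) (f := fun s : ℝ => s) (by fun_prop), h0,
        mul_zero]
    · exact fun i _ => (((h2 i).comp_measurePreserving (measurePreserving_eval ν i)).integrable
        (by norm_num)).const_mul (w i)
  have e : (∑ i, fun t : Fin n → ℝ => w i * t i) = fun t => ∑ i, w i * t i := by
    ext t; simp
  rw [e, variance_of_integral_eq_zero hm.aestronglyMeasurable.aemeasurable hmean] at hvar
  rw [hvar, mul_pow, Real.sq_sqrt (Finset.sum_nonneg fun i _ => sq_nonneg _), Finset.mul_sum]
  refine Finset.sum_le_sum fun i _ => ?_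
  have := variance_const_mul (w i) id (ν i)
  simp only [id] at this
  rw [this, mul_comm (σ ^ 2)]
  exact mul_le_mul_of_nonneg_left (hv i) (sq_nonneg _)

/-- The count has mean `a = n D(B)` and variance at most `a`, so each of the two terms of
`invSqrtOrOne_le` integrates to at most `2/√a`. -/
lemma lintegral_invSqrtOrOne_count_le {α : Type*} [MeasurableSpace α] (D : Measure α)
    [IsProbabilityMeasure D] {B : Set α} [DecidablePred (· ∈ B)] (hB : MeasurableSet B)
    (hn : 0 < n) (hq : 0 < D.real B) :
    ∫⁻ x, ENNReal.ofReal (invSqrtOrOne (∑ i : Fin n, if x i ∈ B then 1 else 0))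
      ∂Measure.pi (fun _ => D) ≤ ENNReal.ofReal (4 / √(n * D.real B)) := by
  set q := D.real B with hqdef
  set a : ℝ := n * q with hadef
  have hn' : (0 : ℝ) < n := by exact_mod_cast hn
  have ha : 0 < a := by positivity
  set ind : α → ℝ := fun x => if x ∈ B then 1 else 0 with hind
  have hindm : Measurable ind := Measurable.ite hB measurable_const measurable_const
  have hindL : MemLp ind 2 D := MemLp.of_bound hindm.aestronglyMeasurable 1
    (ae_of_all _ fun x => by simp only [hind]; split_ifs <;> simp)
  have hindI : ∫ x, ind x ∂D = q := by
    have : ind = B.indicator 1 := by ext x; simp [hind, Set.indicator]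
    rw [this, integral_indicator_one hB]
  have hsq : ∀ x, ind x ^ 2 = ind x := fun x => by simp only [hind]; split_ifs <;> simp
  set N : (Fin n → α) → ℝ := fun x => ∑ i, ind (x i) with hN
  have hNL : MemLp N 2 (Measure.pi fun _ => D) := memLp_finsetSum _ fun i _ =>
    hindL.comp_measurePreserving (measurePreserving_eval (fun _ => D) i)
  have hNmean : ∫ x, N x ∂Measure.pi (fun _ => D) = a := by
    rw [integral_finsetSum]
    · simp_rw [integral_comp_eval (μ := fun _ : Fin n => D) (f := ind) hindm.aestronglyMeasurable]
      simp [hindI, hadef]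
    · exact fun i _ => (hindL.comp_measurePreserving
        (measurePreserving_eval (fun _ => D) i)).integrable (by norm_num)
  have hNvar : ∫ x, (N x - a) ^ 2 ∂Measure.pi (fun _ => D) ≤ a := by
    have h1 := variance_sum_pi (μ := fun _ : Fin n => D) (X := fun _ => ind) (fun i => hindL)
    have e : (∑ i, fun x : Fin n → α => ind (x i)) = N := by ext x; simp [hN]
    rw [e, variance_eq_integral hNL.aestronglyMeasurable.aemeasurable, hNmean] at h1
    rw [h1]
    simp only [Finset.sum_const, Finset.card_univ, Fintype.card_fin, nsmul_eq_mul, hadef]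
    gcongr
    refine (variance_le_expectation_sq hindm.aestronglyMeasurable).trans ?_
    simp only [Pi.pow_apply, hsq, hindI]
    exact le_rfl
  have hN01 : ∀ x, N x = 0 ∨ 1 ≤ N x := fun x => by
    have h1 : N x = ((Finset.univ.filter fun i => x i ∈ B).card : ℝ) := by simp [hN, hind]
    rw [h1]
    rcases Nat.eq_zero_or_pos (Finset.univ.filter fun i => x i ∈ B).card with h2 | h2
    · left; exact_mod_cast h2
    · right; exact_mod_cast h2
  have hNI : Integrable (fun x => (N x - a) ^ 2) (Measure.pi fun _ => D) :=
    (hNL.sub (memLp_const a)).integrable_sq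
  have hs : 0 < √a := Real.sqrt_pos.2 ha
  calc ∫⁻ x, ENNReal.ofReal (invSqrtOrOne (N x)) ∂Measure.pi (fun _ => D)
      ≤ ∫⁻ x, ENNReal.ofReal (2 / √a + 2 / (a * √a) * (N x - a) ^ 2) ∂Measure.pi (fun _ => D) :=
        lintegral_mono fun x => ENNReal.ofReal_le_ofReal (invSqrtOrOne_le (hN01 x) ha)
    _ = ENNReal.ofReal (∫ x, (2 / √a + 2 / (a * √a) * (N x - a) ^ 2)
          ∂Measure.pi (fun _ => D)) :=
        lintegral_ofReal_eq_ofReal_integral ((integrable_const _).add (hNI.const_mul _))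
          fun x => by positivity
    _ ≤ ENNReal.ofReal (4 / √a) := by
        refine ENNReal.ofReal_le_ofReal ?_
        rw [integral_add (integrable_const _) (hNI.const_mul _), integral_const_mul]
        have : 2 / (a * √a) * ∫ x, (N x - a) ^ 2 ∂Measure.pi (fun _ => D) ≤
            2 / (a * √a) * a := by gcongr
        have h5 : 2 / (a * √a) * a = 2 / √a := by field_simp
        simp only [integral_const, probReal_univ, one_smul]
        have : 4 / √a = 2 / √a + 2 / √a := by ring
        linarith

/-- Needed for whole vectors of samples, because the weight of one sample depends on the projections
of all of them. -/
lemma indepFun_pi_of_indepFun {α β γ : Type*} [MeasurableSpace α] [MeasurableSpace β]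
    [MeasurableSpace γ] {D : Measure α} [IsProbabilityMeasure D] {p : α → β} {q : α → γ}
    (hp : Measurable p) (hq : Measurable q) (h : IndepFun p q D) :
    IndepFun (fun (x : Fin n → α) i => p (x i)) (fun (x : Fin n → α) i => q (x i))
      (Measure.pi fun _ => D) := by
  have := Measure.isProbabilityMeasure_map (μ := D) hp.aemeasurable
  have := Measure.isProbabilityMeasure_map (μ := D) hq.aemeasurable
  have hp' : Measurable fun (x : Fin n → α) i => p (x i) := by fun_prop
  have hq' : Measurable fun (x : Fin n → α) i => q (x i) := by fun_prop
  rw [indepFun_iff_map_prod_eq_prod_map_map hp'.aemeasurable hq'.aemeasurable]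
  rw [Measure.pi_map_pi (f := fun _ => p) (fun _ => hp.aemeasurable),
    Measure.pi_map_pi (f := fun _ => q) (fun _ => hq.aemeasurable)]
  rw [← (measurePreserving_arrowProdEquivProdArrow β γ (Fin n) (fun _ => D.map p)
    (fun _ => D.map q)).map_eq,
    ← (indepFun_iff_map_prod_eq_prod_map_map hp.aemeasurable hq.aemeasurable).1 h]
  have := Measure.isProbabilityMeasure_map (μ := D) (hp.prodMk hq).aemeasurable
  rw [← Measure.pi_map_pi (f := fun _ : Fin n => fun x => (p x, q x))
    (fun _ => (hp.prodMk hq).aemeasurable),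
    Measure.map_map (MeasurableEquiv.measurable _) (by fun_prop)]
  rfl

end Product

/-! ### Regression error in a fixed direction: bias and noise -/

section FixedDirection

variable {n d : ℕ} {m θ ϑ e r : EuclideanSpace ℝ (Fin d)} {Q : Matrix (Fin d) (Fin d) ℝ}
  {f : ℝ → ℝ} {Lf Lf' σ κ c h W : ℝ}

lemma abs_sub_le_of_abs_deriv_le (hf : ContDiff ℝ 1 f) (hf' : ∀ t, |deriv f t| ≤ Lf') (s t : ℝ) :
    |f s - f t| ≤ Lf' * |s - t| :=
  convex_univ.norm_image_sub_le_of_norm_deriv_le (𝕜 := ℝ) (f := f)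
    (fun x _ => hf.differentiable one_ne_zero x) (fun x _ => hf' x) (Set.mem_univ t)
    (Set.mem_univ s)

/-- Outside the truncation level or for an empty window the estimator is `0` and the error is at
most `Lf`. Otherwise the weights sum to one, so the error is the averaged noise plus an average of
increments of `f`, which is Lipschitz. -/
lemma kernelRegression_error_le (hf : ContDiff ℝ 1 f) (hfb : ∀ t, |f t| ≤ Lf)
    (hf' : ∀ t, |deriv f t| ≤ Lf') (hh : 0 < h)
    (x : Fin n → EuclideanSpace ℝ (Fin d)) (ε : Fin n → ℝ) (u : EuclideanSpace ℝ (Fin d)) :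
    |kernelRegression m h W ϑ x (fun i => f (inner ℝ (x i) θ) + ε i) (inner ℝ u ϑ)
        - f (inner ℝ u θ)| ≤
      (if W < |inner ℝ (u - m) ϑ| then Lf else 0) +
      (if windowCount h (inner ℝ (u - m) ϑ) (fun i => inner ℝ (x i - m) ϑ) = 0 then Lf else 0) +
      |∑ i, kernelWeight h (inner ℝ (u - m) ϑ) (fun i => inner ℝ (x i - m) ϑ) i * ε i| +
      Lf' * ∑ i, kernelWeight h (inner ℝ (u - m) ϑ) (fun i => inner ℝ (x i - m) ϑ) i *
        |inner ℝ (x i - u) θ| := by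
  have hLf : 0 ≤ Lf := (abs_nonneg _).trans (hfb 0)
  have hLf' : 0 ≤ Lf' := (abs_nonneg _).trans (hf' 0)
  rw [kernelRegression_eq m ϑ hh]
  set p : Fin n → ℝ := fun i => inner ℝ (x i - m) ϑ
  set t : ℝ := inner ℝ (u - m) ϑ
  set w := kernelWeight h t p
  have hw : ∀ i, 0 ≤ w i := kernelWeight_nonneg h t p
  have hS : 0 ≤ Lf' * ∑ i, w i * |inner ℝ (x i - u) θ| :=
    mul_nonneg hLf' (Finset.sum_nonneg fun i _ => mul_nonneg (hw i) (abs_nonneg _))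
  have hA := abs_nonneg (∑ i, w i * ε i)
  have hI : 0 ≤ (if windowCount h t p = 0 then Lf else 0) := by split_ifs <;> simp [hLf]
  by_cases h1 : |t| ≤ W
  · rw [if_pos h1, if_neg (not_lt.2 h1)]
    by_cases h2 : windowCount h t p = 0
    · have hz : ∑ i, w i * (f (inner ℝ (x i) θ) + ε i) = 0 :=
        Finset.sum_eq_zero fun i _ => by simp [w, kernelWeight_eq_zero h2]
      rw [hz, if_pos h2, zero_sub, abs_neg]
      linarith [hfb (inner ℝ u θ)]
    · have hsum : ∑ i, w i = 1 := sum_kernelWeight h2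
      have key : ∑ i, w i * (f (inner ℝ (x i) θ) + ε i) - f (inner ℝ u θ) =
          ∑ i, w i * ε i + ∑ i, w i * (f (inner ℝ (x i) θ) - f (inner ℝ u θ)) := by
        simp_rw [mul_sub, mul_add]
        rw [Finset.sum_add_distrib, Finset.sum_sub_distrib, ← Finset.sum_mul, hsum]
        ring
      rw [key, if_neg h2]
      have hB : |∑ i, w i * (f (inner ℝ (x i) θ) - f (inner ℝ u θ))| ≤
          Lf' * ∑ i, w i * |inner ℝ (x i - u) θ| := by
        rw [Finset.mul_sum]
        refine (Finset.abs_sum_le_sum_abs _ _).trans (Finset.sum_le_sum fun i _ => ?_)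
        rw [abs_mul, abs_of_nonneg (hw i), mul_left_comm, inner_sub_left]
        exact mul_le_mul_of_nonneg_left (abs_sub_le_of_abs_deriv_le hf hf' _ _) (hw i)
      have := abs_add_le (∑ i, w i * ε i) (∑ i, w i * (f (inner ℝ (x i) θ) - f (inner ℝ u θ)))
      linarith
  · rw [if_neg h1, if_pos (not_le.1 h1), zero_sub, abs_neg]
    linarith [hfb (inner ℝ u θ)]

/-- On the window the two projections on `ϑ` differ by at most `h`, which handles both `κ ϑ` and the
part `c ϑ` of `e`. The term in `r` is left inside the weighted sum, where independence will control
it. -/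
lemma sum_kernelWeight_mul_abs_inner_le (hκ : 0 ≤ κ) (hh : 0 ≤ h) (hθ : θ = κ • ϑ - e)
    (he : e = c • ϑ + r) (x : Fin n → EuclideanSpace ℝ (Fin d)) (u : EuclideanSpace ℝ (Fin d)) :
    ∑ i, kernelWeight h (inner ℝ (u - m) ϑ) (fun i => inner ℝ (x i - m) ϑ) i *
        |inner ℝ (x i - u) θ| ≤
      (κ + |c|) * h + |c| * |inner ℝ (u - m) ϑ| + |inner ℝ (u - m) e| +
      ∑ i, kernelWeight h (inner ℝ (u - m) ϑ) (fun i => inner ℝ (x i - m) ϑ) i *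
        |inner ℝ (x i - m) r| := by
  set p : Fin n → ℝ := fun i => inner ℝ (x i - m) ϑ with hp
  set t : ℝ := inner ℝ (u - m) ϑ with ht
  set A := (κ + |c|) * h + |c| * |t| + |inner ℝ (u - m) e|
  have hA : 0 ≤ A := by positivity
  have h1 : ∀ i, kernelWeight h t p i * |inner ℝ (x i - u) θ| ≤
      kernelWeight h t p i * (A + |inner ℝ (x i - m) r|) := fun i =>
    kernelWeight_mul_le fun hi => by
    have e1 : (inner ℝ (x i - u) θ : ℝ) =
        -κ * (t - p i) + (-(c * p i + inner ℝ (x i - m) r) + inner ℝ (u - m) e) := by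
      have e2 : (inner ℝ (x i - m) e : ℝ) = c * p i + inner ℝ (x i - m) r := by
        rw [he, inner_add_right, inner_smul_right]
      rw [← e2, show x i - u = (x i - m) - (u - m) by abel, hθ, inner_sub_left, inner_sub_right,
        inner_sub_right, inner_smul_right, inner_smul_right]
      simp only [ht, hp]
      ring
    have hpi : |p i| ≤ |t| + h := by
      have := abs_sub_abs_le_abs_sub (p i) t
      rw [abs_sub_comm] at this
      linarith
    calc |(inner ℝ (x i - u) θ : ℝ)|
        ≤ |-κ * (t - p i)| + (|-(c * p i + inner ℝ (x i - m) r)| + |inner ℝ (u - m) e|) := by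
          rw [e1]
          exact (abs_add_le _ _).trans (add_le_add_right (abs_add_le _ _) _)
      _ ≤ κ * h + ((|c| * (|t| + h) + |inner ℝ (x i - m) r|) + |inner ℝ (u - m) e|) := by
          rw [abs_mul, abs_neg, abs_of_nonneg hκ, abs_neg]
          gcongr
          refine (abs_add_le _ _).trans ?_
          rw [abs_mul]
          gcongr
      _ = A + |inner ℝ (x i - m) r| := by simp only [A]; ring
  refine (Finset.sum_le_sum fun i _ => h1 i).trans ?_
  simp_rw [mul_add]
  rw [Finset.sum_add_distrib, ← Finset.sum_mul]
  gcongr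
  exact mul_le_of_le_one_left hA (sum_kernelWeight_le_one h t p)

/-- The part of the prediction error bound that depends on the new context only. -/
noncomputable def contextBound (m ϑ e : EuclideanSpace ℝ (Fin d)) (Lf Lf' κ c h W : ℝ)
    (u : EuclideanSpace ℝ (Fin d)) : ℝ :=
  (if W < |inner ℝ (u - m) ϑ| then Lf else 0) +
    Lf' * ((κ + |c|) * h + |c| * |inner ℝ (u - m) ϑ| + |inner ℝ (u - m) e|)

lemma contextBound_nonneg (hLf : 0 ≤ Lf) (hLf' : 0 ≤ Lf') (hκ : 0 ≤ κ) (hh : 0 ≤ h)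
    (u : EuclideanSpace ℝ (Fin d)) : 0 ≤ contextBound m ϑ e Lf Lf' κ c h W u := by
  unfold contextBound
  refine add_nonneg (by split_ifs <;> simp [hLf]) (by positivity)

lemma lintegral_noise_error_le (hf : ContDiff ℝ 1 f) (hfb : ∀ t, |f t| ≤ Lf)
    (hf' : ∀ t, |deriv f t| ≤ Lf') (hh : 0 < h) (hκ : 0 ≤ κ) (hθ : θ = κ • ϑ - e)
    (he : e = c • ϑ + r) (ν : Fin n → Measure ℝ) [∀ i, IsProbabilityMeasure (ν i)]
    (h2 : ∀ i, MemLp id 2 (ν i)) (h0 : ∀ i, ∫ t, t ∂ν i = 0) (hσ : 0 ≤ σ)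
    (hv : ∀ i, variance id (ν i) ≤ σ ^ 2)
    (x : Fin n → EuclideanSpace ℝ (Fin d)) (u : EuclideanSpace ℝ (Fin d)) :
    ∫⁻ ε, ENNReal.ofReal |kernelRegression m h W ϑ x (fun i => f (inner ℝ (x i) θ) + ε i)
        (inner ℝ u ϑ) - f (inner ℝ u θ)| ∂Measure.pi ν ≤
      ENNReal.ofReal (contextBound m ϑ e Lf Lf' κ c h W u) +
      (ENNReal.ofReal (Lf + σ) * ENNReal.ofReal (invSqrtOrOne
        (windowCount h (inner ℝ (u - m) ϑ) (fun i => inner ℝ (x i - m) ϑ))) +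
      ENNReal.ofReal Lf' * ∑ i, ENNReal.ofReal
        (kernelWeight h (inner ℝ (u - m) ϑ) (fun i => inner ℝ (x i - m) ϑ) i) *
          ENNReal.ofReal |inner ℝ (x i - m) r|) := by
  have hLf : 0 ≤ Lf := (abs_nonneg _).trans (hfb 0)
  have hLf' : 0 ≤ Lf' := (abs_nonneg _).trans (hf' 0)
  set p : Fin n → ℝ := fun i => inner ℝ (x i - m) ϑ with hp
  set t : ℝ := inner ℝ (u - m) ϑ with ht
  set w := kernelWeight h t p with hw
  set N := windowCount h t p with hN
  set R := ∑ i, w i * |inner ℝ (x i - m) r|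
  have hw0 : ∀ i, 0 ≤ w i := kernelWeight_nonneg h t p
  have hR : 0 ≤ R := Finset.sum_nonneg fun i _ => mul_nonneg (hw0 i) (abs_nonneg _)
  have hcb := contextBound_nonneg (m := m) (ϑ := ϑ) (e := e) (c := c) (W := W) hLf hLf' hκ hh.le u
  set b : ℝ := if N = 0 then Lf else 0
  have hb : 0 ≤ b := by simp only [b]; split_ifs <;> simp [hLf]
  have hpt : ∀ ε : Fin n → ℝ, |kernelRegression m h W ϑ x (fun i => f (inner ℝ (x i) θ) + ε i)
        (inner ℝ u ϑ) - f (inner ℝ u θ)| ≤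
      (contextBound m ϑ e Lf Lf' κ c h W u + b + Lf' * R) + |∑ i, w i * ε i| := fun ε => by
    refine (kernelRegression_error_le hf hfb hf' hh x ε u).trans ?_
    have := mul_le_mul_of_nonneg_left
      (sum_kernelWeight_mul_abs_inner_le (m := m) hκ hh.le hθ he x u) hLf'
    unfold contextBound
    simp only [← hp, ← ht, ← hw, ← hN] at this ⊢
    simp only [b, R]
    linarith
  refine (lintegral_mono fun ε => ENNReal.ofReal_le_ofReal (hpt ε)).trans ?_
  have hsplit : ∀ ε : Fin n → ℝ, ENNReal.ofReal
      ((contextBound m ϑ e Lf Lf' κ c h W u + b + Lf' * R) + |∑ i, w i * ε i|) =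
      ENNReal.ofReal (contextBound m ϑ e Lf Lf' κ c h W u + b + Lf' * R) +
        ENNReal.ofReal |∑ i, w i * ε i| := fun ε =>
    ENNReal.ofReal_add (by positivity) (abs_nonneg _)
  simp_rw [hsplit]
  rw [lintegral_add_left measurable_const, lintegral_const, measure_univ, mul_one,
    ENNReal.ofReal_add (by positivity) (by positivity), ENNReal.ofReal_add (by positivity) hb]
  have hnoise := lintegral_abs_sum_noise_le ν h2 h0 hσ hv w
  rw [hw, sum_kernelWeight_sq, ← hw, ← hN] at hnoise
  -- The empty-window error and the noise live on complementary cases: for `N = 0` the noise average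
  -- vanishes, for `N ≠ 0` the other term does. Hence `invSqrtOrOne` carries both.
  have hψ : ENNReal.ofReal b + ENNReal.ofReal (σ * √(1 / N)) ≤
      ENNReal.ofReal (Lf + σ) * ENNReal.ofReal (invSqrtOrOne N) := by
    rw [← ENNReal.ofReal_add hb (by positivity), ← ENNReal.ofReal_mul (by positivity)]
    refine ENNReal.ofReal_le_ofReal ?_
    simp only [b, invSqrtOrOne]
    split_ifs with h1
    · simp [h1, hσ]
    · have : √(1 / N) = 1 / √N := by simp
      rw [this, zero_add]
      gcongr
      linarith
  have hRe : ENNReal.ofReal (Lf' * R) = ENNReal.ofReal Lf' * ∑ i, ENNReal.ofReal (w i) *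
      ENNReal.ofReal |inner ℝ (x i - m) r| := by
    rw [ENNReal.ofReal_mul hLf', ENNReal.ofReal_sum_of_nonneg
      fun i _ => mul_nonneg (hw0 i) (abs_nonneg _)]
    congr 1
    exact Finset.sum_congr rfl fun i _ => ENNReal.ofReal_mul (hw0 i)
  rw [← hRe]
  calc _ ≤ ENNReal.ofReal (contextBound m ϑ e Lf Lf' κ c h W u) + ENNReal.ofReal b +
        ENNReal.ofReal (Lf' * R) + ENNReal.ofReal (σ * √(1 / N)) := by gcongr
    _ = ENNReal.ofReal (contextBound m ϑ e Lf Lf' κ c h W u) +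
        ((ENNReal.ofReal b + ENNReal.ofReal (σ * √(1 / N))) + ENNReal.ofReal (Lf' * R)) := by ring
    _ ≤ _ := by gcongr

lemma measurable_windowCount : Measurable fun z : ℝ × (Fin n → ℝ) => windowCount h z.1 z.2 := by
  unfold windowCount
  refine Finset.measurable_sum _ fun i _ => ?_
  exact Measurable.ite (measurableSet_le (by fun_prop) (by fun_prop)) measurable_const
    measurable_const

lemma measurable_kernelWeight (i : Fin n) :
    Measurable fun z : ℝ × (Fin n → ℝ) => kernelWeight h z.1 z.2 i := by
  unfold kernelWeight
  exact (Measurable.ite (measurableSet_le (by fun_prop) (by fun_prop)) measurable_const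
    measurable_const).div measurable_windowCount

lemma measurable_invSqrtOrOne : Measurable invSqrtOrOne := by
  unfold invSqrtOrOne
  exact Measurable.ite (measurableSet_singleton 0) measurable_const (by fun_prop)

/-- The weights depend only on the projections on `ϑ`, which are independent of those on `r`. Each
expectation factors, and the weights sum to at most one. -/
lemma lintegral_sum_kernelWeight_mul_le (hQ : Q.PosSemidef)
    (horth : inner ℝ (sqrtMul Q ϑ) (sqrtMul Q r) = 0) (t : ℝ) :
    ∫⁻ x : Fin n → EuclideanSpace ℝ (Fin d), ∑ i, ENNReal.ofReal
        (kernelWeight h t (fun i => inner ℝ (x i - m) ϑ) i) *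
          ENNReal.ofReal |inner ℝ (x i - m) r| ∂Measure.pi (fun _ => multivariateGaussian m Q) ≤
      ENNReal.ofReal ‖sqrtMul Q r‖ := by
  set D := multivariateGaussian m Q
  have hwm : ∀ i, Measurable fun p : Fin n → ℝ => ENNReal.ofReal (kernelWeight h t p i) := fun i =>
    ((measurable_kernelWeight (h := h) i).comp
      (measurable_const.prodMk measurable_id : Measurable fun p => (t, p))).ennreal_ofReal
  have hpm : Measurable fun (x : Fin n → EuclideanSpace ℝ (Fin d)) i =>
      (inner ℝ (x i - m) ϑ : ℝ) := by fun_prop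
  have hqm : ∀ i, Measurable fun (x : Fin n → EuclideanSpace ℝ (Fin d)) =>
      ENNReal.ofReal |(inner ℝ (x i - m) r : ℝ)| := fun i => by fun_prop
  have hind := indepFun_pi_of_indepFun (n := n) (D := D)
    (p := fun x => (inner ℝ (x - m) ϑ : ℝ)) (q := fun x => (inner ℝ (x - m) r : ℝ))
    (by fun_prop) (by fun_prop) (indepFun_inner_sub hQ horth)
  have hwp : ∀ i, Measurable fun (x : Fin n → EuclideanSpace ℝ (Fin d)) => ENNReal.ofReal
      (kernelWeight h t (fun i => inner ℝ (x i - m) ϑ) i) := fun i => (hwm i).comp hpm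
  have hwq : ∀ i, Measurable fun (x : Fin n → EuclideanSpace ℝ (Fin d)) => ENNReal.ofReal
      (kernelWeight h t (fun i => inner ℝ (x i - m) ϑ) i) *
        ENNReal.ofReal |inner ℝ (x i - m) r| := fun i => (hwp i).mul (hqm i)
  rw [lintegral_finsetSum _ fun i _ => hwq i]
  have hi : ∀ i, ∫⁻ x : Fin n → EuclideanSpace ℝ (Fin d), ENNReal.ofReal
        (kernelWeight h t (fun i => inner ℝ (x i - m) ϑ) i) *
          ENNReal.ofReal |inner ℝ (x i - m) r| ∂Measure.pi (fun _ => D) ≤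
      (∫⁻ x : Fin n → EuclideanSpace ℝ (Fin d), ENNReal.ofReal
        (kernelWeight h t (fun i => inner ℝ (x i - m) ϑ) i) ∂Measure.pi (fun _ => D)) *
        ENNReal.ofReal ‖sqrtMul Q r‖ := fun i => by
    have h1 := lintegral_mul_eq_lintegral_mul_lintegral_of_indepFun (hwp i) (hqm i)
      (hind.comp (φ := fun p => ENNReal.ofReal (kernelWeight h t p i))
        (ψ := fun q : Fin n → ℝ => ENNReal.ofReal |q i|) (hwm i) (by fun_prop))
    simp only [Pi.mul_apply] at h1
    rw [h1]
    gcongr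
    rw [(measurePreserving_eval (fun _ : Fin n => D) i).lintegral_comp
      (f := fun x => ENNReal.ofReal |inner ℝ (x - m) r|) (by fun_prop)]
    exact lintegral_abs_inner_sub_le hQ r
  refine (Finset.sum_le_sum fun i _ => hi i).trans ?_
  rw [← Finset.sum_mul, ← lintegral_finsetSum _ fun i _ => hwp i]
  refine mul_le_of_le_one_left zero_le ?_
  calc _ ≤ ∫⁻ x : Fin n → EuclideanSpace ℝ (Fin d), 1 ∂Measure.pi (fun _ => D) := by
        refine lintegral_mono fun x => ?_
        simp only
        rw [← ENNReal.ofReal_sum_of_nonneg fun i _ => kernelWeight_nonneg _ _ _ _,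
          ← ENNReal.ofReal_one]
        exact ENNReal.ofReal_le_ofReal (sum_kernelWeight_le_one _ _ _)
    _ = 1 := by simp

lemma lintegral_invSqrtOrOne_windowCount_le (hQ : Q.PosSemidef) (hn : 0 < n) (t : ℝ)
    (hq : 0 < windowMass (‖sqrtMul Q ϑ‖₊ ^ 2) h t) :
    ∫⁻ x : Fin n → EuclideanSpace ℝ (Fin d), ENNReal.ofReal (invSqrtOrOne
        (windowCount h t (fun i => inner ℝ (x i - m) ϑ)))
        ∂Measure.pi (fun _ => multivariateGaussian m Q) ≤
      ENNReal.ofReal (4 / √(n * windowMass (‖sqrtMul Q ϑ‖₊ ^ 2) h t)) := by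
  classical
  have hm : Measurable fun x : EuclideanSpace ℝ (Fin d) => (inner ℝ (x - m) ϑ : ℝ) := by fun_prop
  have hB : MeasurableSet {s : ℝ | |t - s| ≤ h} := measurableSet_le (by fun_prop) (by fun_prop)
  have hq2 : windowMass (‖sqrtMul Q ϑ‖₊ ^ 2) h t =
      (multivariateGaussian m Q).real {x | |t - inner ℝ (x - m) ϑ| ≤ h} := by
    rw [windowMass, ← map_inner_sub_eq_gaussianReal (m := m) hQ, map_measureReal_apply hm hB]
    rfl
  rw [hq2] at hq ⊢
  exact lintegral_invSqrtOrOne_count_le (n := n) (multivariateGaussian m Q)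
    (B := {x | |t - inner ℝ (x - m) ϑ| ≤ h}) (hm hB) hn hq

end FixedDirection

/-! ### Regression error in a fixed direction: averaging over design and context -/

section FixedDirection

variable {n d : ℕ} {m θ ϑ e r : EuclideanSpace ℝ (Fin d)} {Q : Matrix (Fin d) (Fin d) ℝ}
  {f : ℝ → ℝ} {Lf Lf' σ κ c h W a : ℝ}

lemma lintegral_sample_error_le (hQ : Q.PosSemidef) (hn : 0 < n) (hf : ContDiff ℝ 1 f)
    (hfb : ∀ t, |f t| ≤ Lf) (hf' : ∀ t, |deriv f t| ≤ Lf') (hh : 0 < h) (hκ : 0 ≤ κ)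
    (hθ : θ = κ • ϑ - e) (he : e = c • ϑ + r)
    (horth : inner ℝ (sqrtMul Q ϑ) (sqrtMul Q r) = 0)
    (ν : Fin n → Measure ℝ) [∀ i, IsProbabilityMeasure (ν i)]
    (h2 : ∀ i, MemLp id 2 (ν i)) (h0 : ∀ i, ∫ t, t ∂ν i = 0) (hσ : 0 ≤ σ)
    (hv : ∀ i, variance id (ν i) ≤ σ ^ 2) (u : EuclideanSpace ℝ (Fin d))
    (hq : 0 < windowMass (‖sqrtMul Q ϑ‖₊ ^ 2) h (inner ℝ (u - m) ϑ)) :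
    ∫⁻ x, ∫⁻ ε, ENNReal.ofReal |kernelRegression m h W ϑ x (fun i => f (inner ℝ (x i) θ) + ε i)
        (inner ℝ u ϑ) - f (inner ℝ u θ)| ∂Measure.pi ν
        ∂Measure.pi (fun _ => multivariateGaussian m Q) ≤
      ENNReal.ofReal (contextBound m ϑ e Lf Lf' κ c h W u) +
      (ENNReal.ofReal (Lf + σ) * ENNReal.ofReal
        (4 / √(n * windowMass (‖sqrtMul Q ϑ‖₊ ^ 2) h (inner ℝ (u - m) ϑ))) +
      ENNReal.ofReal Lf' * ENNReal.ofReal ‖sqrtMul Q r‖) := by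
  have hpm : Measurable fun (x : Fin n → EuclideanSpace ℝ (Fin d)) =>
      ((inner ℝ (u - m) ϑ : ℝ), fun i => (inner ℝ (x i - m) ϑ : ℝ)) := by fun_prop
  have hm1 : Measurable fun (x : Fin n → EuclideanSpace ℝ (Fin d)) =>
      ENNReal.ofReal (invSqrtOrOne
        (windowCount h (inner ℝ (u - m) ϑ) (fun i => inner ℝ (x i - m) ϑ))) :=
    (measurable_invSqrtOrOne.comp (measurable_windowCount.comp hpm)).ennreal_ofReal
  refine (lintegral_mono fun x => lintegral_noise_error_le hf hfb hf' hh hκ hθ he ν h2 h0 hσ hv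
    x u).trans ?_
  rw [lintegral_add_left measurable_const, lintegral_const, measure_univ, mul_one,
    lintegral_add_left (hm1.const_mul _), lintegral_const_mul _ hm1,
    lintegral_const_mul' _ _ ENNReal.ofReal_ne_top]
  gcongr
  · exact lintegral_invSqrtOrOne_windowCount_le hQ hn _ hq
  · exact lintegral_sum_kernelWeight_mul_le hQ horth _

lemma lintegral_contextBound_le (hQ : Q.PosSemidef) (hLf : 0 ≤ Lf) (hLf' : 0 ≤ Lf')
    (hκ : 0 ≤ κ) (hh : 0 ≤ h) (hW : 0 ≤ W) (h1 : ‖sqrtMul Q ϑ‖ ≤ 1) :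
    ∫⁻ u, ENNReal.ofReal (contextBound m ϑ e Lf Lf' κ c h W u) ∂multivariateGaussian m Q ≤
      ENNReal.ofReal (2 * Lf * Real.exp (-W ^ 2 / 2) +
        Lf' * ((κ + |c|) * h + |c| * ‖sqrtMul Q ϑ‖ + ‖sqrtMul Q e‖)) := by
  set D := multivariateGaussian m Q
  have hm : ∀ v : EuclideanSpace ℝ (Fin d), Measurable fun u : EuclideanSpace ℝ (Fin d) =>
      (inner ℝ (u - m) v : ℝ) := fun v => by fun_prop
  have hS : MeasurableSet {t : ℝ | W < |t|} := measurableSet_lt (by fun_prop) (by fun_prop)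
  have hS' : MeasurableSet {u : EuclideanSpace ℝ (Fin d) | W < |inner ℝ (u - m) ϑ|} := hm ϑ hS
  have hpt : ∀ u, ENNReal.ofReal (contextBound m ϑ e Lf Lf' κ c h W u) =
      ENNReal.ofReal Lf * {u | W < |inner ℝ (u - m) ϑ|}.indicator 1 u +
        (ENNReal.ofReal (Lf' * ((κ + |c|) * h)) + (ENNReal.ofReal (Lf' * |c|) *
          ENNReal.ofReal |inner ℝ (u - m) ϑ| +
          ENNReal.ofReal Lf' * ENNReal.ofReal |inner ℝ (u - m) e|)) := fun u => by
    rw [← ENNReal.ofReal_mul (by positivity), ← ENNReal.ofReal_mul hLf',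
      ← ENNReal.ofReal_add (by positivity) (by positivity),
      ← ENNReal.ofReal_add (by positivity) (by positivity), contextBound,
      ENNReal.ofReal_add (by split_ifs <;> simp [hLf]) (by positivity)]
    congr 1
    · by_cases hu : W < |inner ℝ (u - m) ϑ|
      · simp [hu]
      · simp [hu]
    · congr 1; ring
  simp_rw [hpt]
  have hms : Measurable fun u => ENNReal.ofReal Lf *
      {u : EuclideanSpace ℝ (Fin d) | W < |inner ℝ (u - m) ϑ|}.indicator 1 u :=
    (measurable_one.indicator hS').const_mul _
  rw [lintegral_add_left hms, lintegral_const_mul _ (measurable_one.indicator hS'),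
    lintegral_indicator_one hS', lintegral_add_left measurable_const, lintegral_const,
    measure_univ, mul_one, lintegral_add_left (by fun_prop), lintegral_const_mul _ (by fun_prop),
    lintegral_const_mul _ (by fun_prop)]
  have htail : D {u | W < |inner ℝ (u - m) ϑ|} ≤ ENNReal.ofReal (2 * Real.exp (-W ^ 2 / 2)) := by
    have h3 := gaussianReal_abs_gt_le (v := ‖sqrtMul Q ϑ‖₊ ^ 2) (pow_le_one₀ zero_le h1) hW
    rw [← map_inner_sub_eq_gaussianReal (m := m) hQ, Measure.map_apply (hm ϑ) hS] at h3
    exact h3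
  calc _ ≤ ENNReal.ofReal Lf * ENNReal.ofReal (2 * Real.exp (-W ^ 2 / 2)) +
        (ENNReal.ofReal (Lf' * ((κ + |c|) * h)) +
          (ENNReal.ofReal (Lf' * |c|) * ENNReal.ofReal ‖sqrtMul Q ϑ‖ +
            ENNReal.ofReal Lf' * ENNReal.ofReal ‖sqrtMul Q e‖)) := by
        gcongr
        · exact lintegral_abs_inner_sub_le hQ ϑ
        · exact lintegral_abs_inner_sub_le hQ e
    _ = _ := by
        rw [← ENNReal.ofReal_mul (by positivity), ← ENNReal.ofReal_mul (by positivity),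
          ← ENNReal.ofReal_mul (by positivity),
          ← ENNReal.ofReal_add (by positivity) (by positivity),
          ← ENNReal.ofReal_add (by positivity) (by positivity),
          ← ENNReal.ofReal_add (by positivity) (by positivity)]
        congr 1; ring

/-- If `ϑ = 0` every window has mass one. Otherwise `h` is at most `a` standard deviations of the
projection, so the exponential factor in `lintegral_inv_sqrt_windowMass_le` is at most `exp(a²/4)`.
-/
lemma lintegral_inv_sqrt_windowMass_inner_le (hQ : Q.PosSemidef) (hn : 0 < n) (hh : 0 < h)
    (hh1 : h ≤ 1) (h1 : ‖sqrtMul Q ϑ‖ ≤ 1)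
    (hϑ : ϑ = 0 ∨ (sqrtMul Q ϑ ≠ 0 ∧ h ≤ a * ‖sqrtMul Q ϑ‖)) :
    ∫⁻ u, ENNReal.ofReal (4 / √(n * windowMass (‖sqrtMul Q ϑ‖₊ ^ 2) h (inner ℝ (u - m) ϑ)))
        ∂multivariateGaussian m Q ≤
      ENNReal.ofReal (12 * Real.exp (a ^ 2 / 4) / √(n * h)) := by
  have hn' : (0 : ℝ) < n := by exact_mod_cast hn
  rcases hϑ with rfl | ⟨hϑ, ha⟩
  · have h0 : sqrtMul Q 0 = 0 := by simpa using sqrtMul_smul (Q := Q) 0 0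
    have hq : windowMass 0 h 0 = 1 := by
      simp [windowMass, hh.le, measureReal_def]
    simp only [inner_zero_right, h0, nnnorm_zero, ne_eq, OfNat.ofNat_ne_zero, not_false_eq_true,
      zero_pow, hq, mul_one, lintegral_const, measure_univ]
    refine ENNReal.ofReal_le_ofReal ?_
    have h5 : √(n * h) ≤ √n := Real.sqrt_le_sqrt (by nlinarith)
    have h6 : 0 < √(n * h) := Real.sqrt_pos.2 (by positivity)
    have h7 : 1 ≤ Real.exp (a ^ 2 / 4) := Real.one_le_exp (by positivity)
    gcongr
    linarith
  · set v : NNReal := ‖sqrtMul Q ϑ‖₊ ^ 2 with hv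
    have hs : 0 < ‖sqrtMul Q ϑ‖ := norm_pos_iff.2 hϑ
    have hv0 : v ≠ 0 := by simpa [hv] using hϑ
    have hvr : (v : ℝ) = ‖sqrtMul Q ϑ‖ ^ 2 := by simp [hv]
    have hmeas : Measurable fun t => ENNReal.ofReal (1 / √(n * windowMass v h t)) := by
      have := measurable_windowMass v h
      fun_prop
    have e1 : ∀ t, ENNReal.ofReal (4 / √(n * windowMass v h t)) =
        4 * ENNReal.ofReal (1 / √(n * windowMass v h t)) := fun t => by
      rw [← ENNReal.ofReal_ofNat, ← ENNReal.ofReal_mul (by norm_num)]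
      congr 1; ring
    simp_rw [e1]
    rw [← lintegral_map (μ := multivariateGaussian m Q)
      (f := fun t => 4 * ENNReal.ofReal (1 / √(n * windowMass v h t)))
      (g := fun u => inner ℝ (u - m) ϑ) (hmeas.const_mul 4) (by fun_prop),
      map_inner_sub_eq_gaussianReal hQ, lintegral_const_mul _ hmeas]
    refine (mul_le_mul_right (lintegral_inv_sqrt_windowMass_le hv0
      (pow_le_one₀ zero_le h1) hh hn') _).trans ?_
    rw [← ENNReal.ofReal_ofNat, ← ENNReal.ofReal_mul (by norm_num)]
    refine ENNReal.ofReal_le_ofReal ?_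
    have h5 : Real.exp (h ^ 2 / (4 * v)) ≤ Real.exp (a ^ 2 / 4) := by
      refine Real.exp_le_exp.2 ?_
      rw [hvr, div_le_div_iff₀ (by positivity) (by norm_num)]
      have : h ^ 2 ≤ (a * ‖sqrtMul Q ϑ‖) ^ 2 := by gcongr
      nlinarith
    calc _ = 12 * Real.exp (h ^ 2 / (4 * v)) / √(n * h) := by simp; ring
      _ ≤ _ := by gcongr

/-- Mean absolute prediction error of the kernel regression estimator in a fixed direction. -/
lemma lintegral_kernelRegression_error_le (hQ : Q.PosSemidef) (hn : 0 < n) (hf : ContDiff ℝ 1 f)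
    (hfb : ∀ t, |f t| ≤ Lf) (hf' : ∀ t, |deriv f t| ≤ Lf') (hh : 0 < h) (hh1 : h ≤ 1)
    (hW : 0 ≤ W) (hκ : 0 ≤ κ) (ha : 0 ≤ a)
    (hθ : θ = κ • ϑ - e) (h1 : ‖sqrtMul Q ϑ‖ ≤ 1)
    (hϑ : ϑ = 0 ∨ (sqrtMul Q ϑ ≠ 0 ∧ h ≤ a * ‖sqrtMul Q ϑ‖))
    (ν : Fin n → Measure ℝ) [∀ i, IsProbabilityMeasure (ν i)]
    (h2 : ∀ i, MemLp id 2 (ν i)) (h0 : ∀ i, ∫ t, t ∂ν i = 0) (hσ : 0 ≤ σ)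
    (hv : ∀ i, variance id (ν i) ≤ σ ^ 2) :
    ∫⁻ u, ∫⁻ x, ∫⁻ ε, ENNReal.ofReal |kernelRegression m h W ϑ x
        (fun i => f (inner ℝ (x i) θ) + ε i)
        (inner ℝ u ϑ) - f (inner ℝ u θ)| ∂Measure.pi ν
        ∂Measure.pi (fun _ => multivariateGaussian m Q) ∂multivariateGaussian m Q ≤
      ENNReal.ofReal (2 * Lf * Real.exp (-W ^ 2 / 2) + Lf' * (κ * h + (a + 3) * ‖sqrtMul Q e‖) +
        (Lf + σ) * (12 * Real.exp (a ^ 2 / 4) / √(n * h))) := by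
  have hLf : 0 ≤ Lf := (abs_nonneg _).trans (hfb 0)
  have hLf' : 0 ≤ Lf' := (abs_nonneg _).trans (hf' 0)
  set s := ‖sqrtMul Q ϑ‖ with hs
  set E := ‖sqrtMul Q e‖ with hE
  -- Orthogonal decomposition of `e` in the inner product of `Q`; Pythagoras gives the bounds on `c`
  -- and `r`, and `h ≤ a s` the last one. For `ϑ = 0` take `c = 0` and `r = e`.
  obtain ⟨c, r, he, horth, hcs, hrE, hch⟩ : ∃ (c : ℝ) (r : EuclideanSpace ℝ (Fin d)),
      e = c • ϑ + r ∧ inner ℝ (sqrtMul Q ϑ) (sqrtMul Q r) = 0 ∧ |c| * s ≤ E ∧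
      ‖sqrtMul Q r‖ ≤ E ∧ |c| * h ≤ a * E := by
    rcases hϑ with rfl | ⟨hϑ, hah⟩
    · have h0 : sqrtMul Q 0 = 0 := by simpa using sqrtMul_smul (Q := Q) 0 0
      exact ⟨0, e, by simp, by simp [h0], by simp [E], le_rfl, by simp; positivity⟩
    have hs0 : 0 < s := norm_pos_iff.2 hϑ
    set c := inner ℝ (sqrtMul Q ϑ) (sqrtMul Q e) / s ^ 2 with hc
    have hr : sqrtMul Q e = c • sqrtMul Q ϑ + sqrtMul Q (e - c • ϑ) := by
      rw [← sqrtMul_smul, ← sqrtMul_add]; simp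
    have horth : inner ℝ (sqrtMul Q ϑ) (sqrtMul Q (e - c • ϑ)) = 0 := by
      have h3 : sqrtMul Q (e - c • ϑ) = sqrtMul Q e - c • sqrtMul Q ϑ := by
        rw [hr]; simp
      rw [h3, inner_sub_right, inner_smul_right, real_inner_self_eq_norm_sq, hc,
        div_mul_cancel₀ _ (by positivity), sub_self]
    have hpyth : E ^ 2 = (|c| * s) ^ 2 + ‖sqrtMul Q (e - c • ϑ)‖ ^ 2 := by
      have := norm_add_sq_eq_norm_sq_add_norm_sq_real
        (x := c • sqrtMul Q ϑ) (y := sqrtMul Q (e - c • ϑ))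
        (by rw [inner_smul_left, horth, mul_zero])
      rw [← hr, norm_smul, Real.norm_eq_abs] at this
      rw [hE, hs]; nlinarith
    have hcs : |c| * s ≤ E := by
      refine (abs_le_of_sq_le_sq' ?_ (norm_nonneg _)).2
      nlinarith [sq_nonneg ‖sqrtMul Q (e - c • ϑ)‖]
    refine ⟨c, e - c • ϑ, by simp, horth, hcs, ?_, ?_⟩
    · refine (abs_le_of_sq_le_sq' ?_ (norm_nonneg _)).2
      nlinarith [sq_nonneg (|c| * s)]
    · calc |c| * h ≤ |c| * (a * s) := by gcongr
        _ = a * (|c| * s) := by ring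
        _ ≤ a * E := by gcongr
  -- Positivity is needed because `4 / √0` is `0` in Lean and would bound nothing.
  have hq : ∀ u : EuclideanSpace ℝ (Fin d),
      0 < windowMass (‖sqrtMul Q ϑ‖₊ ^ 2) h (inner ℝ (u - m) ϑ) := fun u =>
    windowMass_pos _ hh _ fun hz => by
      rcases hϑ with rfl | ⟨hϑ, _⟩
      · simp
      · simp [hϑ] at hz
  refine (lintegral_mono fun u => lintegral_sample_error_le hQ hn hf hfb hf' hh hκ hθ he horth ν h2
    h0 hσ hv u (hq u)).trans ?_
  have hmeas : Measurable fun u : EuclideanSpace ℝ (Fin d) =>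
      ENNReal.ofReal (4 / √(n * windowMass (‖sqrtMul Q ϑ‖₊ ^ 2) h (inner ℝ (u - m) ϑ))) := by
    have := measurable_windowMass (‖sqrtMul Q ϑ‖₊ ^ 2) h
    fun_prop
  have hmeas' : Measurable fun u : EuclideanSpace ℝ (Fin d) => ENNReal.ofReal (Lf + σ) *
      ENNReal.ofReal (4 / √(n * windowMass (‖sqrtMul Q ϑ‖₊ ^ 2) h (inner ℝ (u - m) ϑ))) +
        ENNReal.ofReal Lf' * ENNReal.ofReal ‖sqrtMul Q r‖ :=
    (hmeas.const_mul _).add measurable_const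
  rw [lintegral_add_right _ hmeas',
    lintegral_add_left (hmeas.const_mul _), lintegral_const, measure_univ, mul_one,
    lintegral_const_mul _ hmeas]
  have hsn : 0 < √(n * h) := Real.sqrt_pos.2 (by positivity)
  calc _ ≤ ENNReal.ofReal (2 * Lf * Real.exp (-W ^ 2 / 2) +
          Lf' * ((κ + |c|) * h + |c| * s + E)) +
        (ENNReal.ofReal (Lf + σ) * ENNReal.ofReal (12 * Real.exp (a ^ 2 / 4) / √(n * h)) +
          ENNReal.ofReal Lf' * ENNReal.ofReal ‖sqrtMul Q r‖) := by
        gcongr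
        · exact lintegral_contextBound_le hQ hLf hLf' hκ hh.le hW h1
        · exact lintegral_inv_sqrt_windowMass_inner_le hQ hn hh hh1 h1 hϑ
    _ ≤ _ := by
        have hs' : 0 ≤ s := norm_nonneg _
        have hE' : 0 ≤ E := norm_nonneg _
        rw [← ENNReal.ofReal_mul (by positivity), ← ENNReal.ofReal_mul (by positivity),
          ← ENNReal.ofReal_add (by positivity) (by positivity),
          ← ENNReal.ofReal_add (by positivity) (by positivity)]
        refine ENNReal.ofReal_le_ofReal ?_
        -- The constant `a + 3` collects `|c| h ≤ a E`, `|c| s ≤ E`, the term `E` itself and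
        -- `‖Q^{1/2} r‖ ≤ E`.
        have : Lf' * ((κ + |c|) * h + |c| * s + E + ‖sqrtMul Q r‖) ≤
            Lf' * (κ * h + (a + 3) * E) := by
          refine mul_le_mul_of_nonneg_left ?_ hLf'
          nlinarith
        nlinarith

end FixedDirection

/-! ### Truncated means -/

section Truncation

/-- Truncation of a real number at level `τ`. -/
noncomputable def clamp (τ v : ℝ) : ℝ := Real.sign v * min |v| τ

lemma clamp_eq {τ : ℝ} (hτ : 0 < τ) (v : ℝ) : clamp τ v = max (-τ) (min v τ) := by
  unfold clamp
  rcases lt_trichotomy v 0 with hv | rfl | hv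
  · rw [Real.sign_of_neg hv, abs_of_neg hv, min_eq_left (by linarith : v ≤ τ)]
    rcases le_total (-v) τ with h | h
    · rw [min_eq_left h, max_eq_right (by linarith)]; ring
    · rw [min_eq_right h, max_eq_left (by linarith)]; ring
  · simp [hτ.le]
  · rw [Real.sign_of_pos hv, abs_of_pos hv, one_mul, max_eq_right]
    exact le_min (by linarith) (by linarith)

lemma measurable_clamp {τ : ℝ} (hτ : 0 < τ) : Measurable (clamp τ) := by
  have : clamp τ = fun v => max (-τ) (min v τ) := funext (clamp_eq hτ)
  rw [this]; fun_prop

lemma clamp_neg (τ v : ℝ) : clamp τ (-v) = -clamp τ v := by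
  simp [clamp, Real.sign_neg]

lemma abs_clamp {τ : ℝ} (hτ : 0 < τ) (v : ℝ) : |clamp τ v| = min |v| τ := by
  unfold clamp
  have hm : 0 ≤ min |v| τ := le_min (abs_nonneg _) hτ.le
  rw [abs_mul, abs_of_nonneg hm]
  rcases Real.sign_apply_eq v with h | h | h
  · simp [h]
  · have : v = 0 := Real.sign_eq_zero_iff.1 h
    simp [this, hτ.le]
  · simp [h]

lemma clamp_sq_le {τ : ℝ} (hτ : 0 < τ) (v : ℝ) : clamp τ v ^ 2 ≤ v ^ 2 := by
  rw [sq_le_sq, abs_clamp hτ]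
  exact min_le_left _ _

/-- At the lower level `-τ` this is `v² + vτ + τ² ≥ 0`. By oddness it bounds the truncation error by
`v²/τ`, so second moments suffice to control the bias. -/
lemma clamp_le_add {τ : ℝ} (hτ : 0 < τ) (v : ℝ) : clamp τ v ≤ v + v ^ 2 / τ := by
  rw [clamp_eq hτ]
  have h0 : 0 ≤ v ^ 2 / τ := by positivity
  refine max_le ?_ ((min_le_left _ _).trans (by linarith))
  have : v ^ 2 / τ * τ = v ^ 2 := by field_simp
  rw [← sub_nonneg]
  have h1 : 0 ≤ (v + v ^ 2 / τ - -τ) * τ := by nlinarith [sq_nonneg (v + τ), sq_nonneg v]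
  exact nonneg_of_mul_nonneg_left h1 hτ

lemma abs_clamp_sub_le {τ : ℝ} (hτ : 0 < τ) (v : ℝ) : |clamp τ v - v| ≤ v ^ 2 / τ := by
  have h1 := clamp_le_add hτ v
  have h2 := clamp_le_add hτ (-v)
  rw [clamp_neg, neg_sq] at h2
  exact abs_le.2 ⟨by linarith, by linarith⟩

variable {Ω : Type*} [MeasurableSpace Ω] {P : Measure Ω} [IsProbabilityMeasure P]
  {n : ℕ} {b V τ : ℝ}

lemma memLp_clamp (hτ : 0 < τ) {Z : Ω → ℝ} (hZ : AEMeasurable Z P) (p : ENNReal) :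
    MemLp (fun ω => clamp τ (Z ω)) p P :=
  MemLp.of_bound ((measurable_clamp hτ).comp_aemeasurable hZ).aestronglyMeasurable τ
    (ae_of_all _ fun ω => by rw [Real.norm_eq_abs, abs_clamp hτ]; exact min_le_right _ _)

lemma abs_integral_clamp_sub_le (hτ : 0 < τ) {Z : Ω → ℝ} (hZ : MemLp Z 2 P)
    (hb : ∫ ω, Z ω ∂P = b) (hV : ∫ ω, Z ω ^ 2 ∂P ≤ V) :
    |∫ ω, clamp τ (Z ω) ∂P - b| ≤ V / τ := by
  have hI := (memLp_clamp hτ hZ.aestronglyMeasurable.aemeasurable 1).integrable le_rfl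
  rw [← hb, ← integral_sub hI (hZ.integrable (by norm_num))]
  refine abs_integral_le_integral_abs.trans ?_
  refine (integral_mono_of_nonneg (ae_of_all _ fun _ => abs_nonneg _)
    (hZ.integrable_sq.div_const τ) (ae_of_all _ fun ω => abs_clamp_sub_le hτ (Z ω))).trans ?_
  rw [integral_div]
  gcongr

lemma integral_clamp_sq_le {P : Measure Ω} (hτ : 0 < τ) {Z : Ω → ℝ} (hZ : MemLp Z 2 P)
    (hV : ∫ ω, Z ω ^ 2 ∂P ≤ V) : ∫ ω, clamp τ (Z ω) ^ 2 ∂P ≤ V :=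
  (integral_mono_of_nonneg (ae_of_all _ fun _ => sq_nonneg _) hZ.integrable_sq
    (ae_of_all _ fun ω => clamp_sq_le hτ (Z ω))).trans hV

/-- Mean squared error of the truncated mean. -/
lemma integral_truncatedMean_sub_sq_le (hn : 0 < n) (hτ : 0 < τ) {Z : Fin n → Ω → ℝ}
    (hZ : ∀ i, MemLp (Z i) 2 P) (hind : iIndepFun Z P) (hb : ∀ i, ∫ ω, Z i ω ∂P = b)
    (hV : ∀ i, ∫ ω, Z i ω ^ 2 ∂P ≤ V) :
    ∫ ω, ((1 / n : ℝ) * ∑ i, clamp τ (Z i ω) - b) ^ 2 ∂P ≤ V / n + (V / τ) ^ 2 := by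
  have hn' : (0 : ℝ) < n := by exact_mod_cast hn
  set Y : Fin n → Ω → ℝ := fun i ω => clamp τ (Z i ω) with hY
  have hYL : ∀ i, MemLp (Y i) 2 P := fun i =>
    memLp_clamp hτ (hZ i).aestronglyMeasurable.aemeasurable 2
  have hYind : iIndepFun Y P := hind.comp (fun _ => clamp τ) fun _ => measurable_clamp hτ
  set S : Ω → ℝ := fun ω => ∑ i, Y i ω with hS
  have hSL : MemLp S 2 P := memLp_finsetSum _ fun i _ => hYL i
  have hvar : variance S P ≤ n * V := by
    have e : S = ∑ i, Y i := by ext ω; simp [hS]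
    rw [e, IndepFun.variance_sum (fun i _ => hYL i) fun i _ j _ hij => hYind.indepFun hij]
    calc ∑ i, variance (Y i) P ≤ ∑ _i : Fin n, V := Finset.sum_le_sum fun i _ =>
          (variance_le_expectation_sq (hYL i).aestronglyMeasurable).trans
            (integral_clamp_sq_le hτ (hZ i) (hV i))
      _ = n * V := by simp
  set M := (1 / n : ℝ) * ∫ ω, S ω ∂P with hM
  have hbias : (M - b) ^ 2 ≤ (V / τ) ^ 2 := by
    rw [← sq_abs]
    have e : M - b = (1 / n : ℝ) * ∑ i, (∫ ω, Y i ω ∂P - b) := by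
      rw [hM, hS, integral_finsetSum _ fun i _ => (hYL i).integrable (by norm_num),
        Finset.sum_sub_distrib]
      simp
      field_simp
    have h1 : |M - b| ≤ V / τ := by
      rw [e, abs_mul, abs_of_pos (by positivity : (0 : ℝ) < 1 / n)]
      calc (1 / n : ℝ) * |∑ i, (∫ ω, Y i ω ∂P - b)| ≤ (1 / n : ℝ) * ∑ _i : Fin n, V / τ := by
            gcongr
            refine (Finset.abs_sum_le_sum_abs _ _).trans (Finset.sum_le_sum fun i _ => ?_)
            exact abs_integral_clamp_sub_le hτ (hZ i) (hb i) (hV i)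
        _ = V / τ := by simp; field_simp
    gcongr
  have hvar' : variance (fun ω => (1 / n : ℝ) * S ω) P ≤ V / n := by
    rw [variance_const_mul]
    calc (1 / n : ℝ) ^ 2 * variance S P ≤ (1 / n : ℝ) ^ 2 * (n * V) := by gcongr
      _ = V / n := by field_simp
  have hTL : MemLp (fun ω => (1 / n : ℝ) * S ω) 2 P := hSL.const_mul _
  have hTb : MemLp (fun ω => (1 / n : ℝ) * S ω - b) 2 P := hTL.sub (memLp_const b)
  -- Bias-variance decomposition: the mean squared error is the variance plus `(M - b)²`.
  have h2 := variance_eq_sub hTb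
  rw [variance_sub_const hTL.aestronglyMeasurable] at h2
  have h3 : ∫ ω, ((1 / n : ℝ) * S ω - b) ∂P = M - b := by
    rw [integral_sub (hTL.integrable (by norm_num)) (integrable_const b), integral_const_mul]
    simp [hM]
  simp only [Pi.pow_apply] at h2
  rw [h3] at h2
  linarith

/-- Chernoff's bound at parameter `1/τ`. The truncated variable divided by `τ` lies in `[-1, 1]`,
where `eᵘ ≤ 1 + u + u²`. Of the two terms `V/τ²` per sample, one is the truncation bias and the
other the second moment. -/
lemma measureReal_truncatedMean_sub_ge_le (hn : 0 < n) (hτ : 0 < τ) {Z : Fin n → Ω → ℝ}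
    (hZ : ∀ i, MemLp (Z i) 2 P) (hind : iIndepFun Z P) (hb : ∀ i, ∫ ω, Z i ω ∂P = b)
    (hV : ∀ i, ∫ ω, Z i ω ^ 2 ∂P ≤ V) (s : ℝ) :
    P.real {ω | s ≤ (1 / n : ℝ) * ∑ i, clamp τ (Z i ω) - b} ≤
      Real.exp (2 * n * V / τ ^ 2 - n * s / τ) := by
  have hn' : (0 : ℝ) < n := by exact_mod_cast hn
  set Y : Fin n → Ω → ℝ := fun i ω => clamp τ (Z i ω) - b with hY
  have hYm : ∀ i, AEMeasurable (Y i) P := fun i =>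
    ((measurable_clamp hτ).comp_aemeasurable (hZ i).aestronglyMeasurable.aemeasurable).sub_const b
  have hYind : iIndepFun Y P :=
    hind.comp (fun _ z => clamp τ z - b) fun _ => (measurable_clamp hτ).sub_const b
  have hset : {ω | s ≤ (1 / n : ℝ) * ∑ i, clamp τ (Z i ω) - b} =
      {ω | n * s ≤ (∑ i, Y i) ω} := by
    ext ω
    simp only [Set.mem_ofPred_eq, Finset.sum_apply, hY, Finset.sum_sub_distrib, Finset.sum_const,
      Finset.card_univ, Fintype.card_fin, nsmul_eq_mul]
    rw [← mul_le_mul_iff_right₀ hn']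
    have : (n : ℝ) * (1 / n * ∑ i, clamp τ (Z i ω) - b) = ∑ i, clamp τ (Z i ω) - n * b := by
      field_simp
    rw [this]
  have hbd : ∀ i ω, |(1 / τ) * Y i ω| ≤ 1 + |b| / τ := fun i ω => by
    rw [abs_mul, abs_of_pos (by positivity : 0 < 1 / τ)]
    have h1 : |Y i ω| ≤ τ + |b| := (abs_sub _ _).trans (by
      rw [abs_clamp hτ]; gcongr; exact min_le_right _ _)
    calc 1 / τ * |Y i ω| ≤ 1 / τ * (τ + |b|) := by gcongr
      _ = 1 + |b| / τ := by field_simp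
  have hexpI : Integrable (fun ω => Real.exp ((1 / τ) * (∑ i, Y i) ω)) P := by
    refine Integrable.of_bound (C := Real.exp (n * (1 + |b| / τ))) ?_ (ae_of_all _ fun ω => ?_)
    · have : AEMeasurable (∑ i, Y i) P := Finset.aemeasurable_sum _ fun i _ => hYm i
      exact (Real.measurable_exp.comp_aemeasurable (this.const_mul _)).aestronglyMeasurable
    · rw [Real.norm_eq_abs, Real.abs_exp]
      refine Real.exp_le_exp.2 ?_
      rw [Finset.sum_apply, Finset.mul_sum]
      calc ∑ i, 1 / τ * Y i ω ≤ ∑ _i : Fin n, (1 + |b| / τ) :=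
            Finset.sum_le_sum fun i _ => (le_abs_self _).trans (hbd i ω)
        _ = _ := by simp; ring
  rw [hset]
  refine (measure_ge_le_exp_mul_mgf (n * s) (by positivity : 0 ≤ 1 / τ) hexpI).trans ?_
  have hmgf : ∀ i, mgf (Y i) P (1 / τ) ≤ Real.exp (2 * V / τ ^ 2) := fun i => by
    have hcI := (memLp_clamp (P := P) hτ (hZ i).aestronglyMeasurable.aemeasurable 1).integrable
      le_rfl
    have hcI2 := (memLp_clamp (P := P) hτ (hZ i).aestronglyMeasurable.aemeasurable 2).integrable_sq
    have h1 : ∀ ω, Real.exp (1 / τ * Y i ω) ≤ Real.exp (-b / τ) *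
        (1 + (1 / τ) * clamp τ (Z i ω) + (1 / τ ^ 2) * clamp τ (Z i ω) ^ 2) := fun ω => by
      have e1 : 1 / τ * Y i ω = -b / τ + clamp τ (Z i ω) / τ := by simp only [hY]; ring
      rw [e1, Real.exp_add]
      gcongr
      have h2 : |clamp τ (Z i ω) / τ| ≤ 1 := by
        rw [abs_div, abs_of_pos hτ, div_le_one hτ, abs_clamp hτ]; exact min_le_right _ _
      have h3 := (abs_le.1 (Real.abs_exp_sub_one_sub_id_le h2)).2
      calc _ ≤ 1 + clamp τ (Z i ω) / τ + (clamp τ (Z i ω) / τ) ^ 2 := by linarith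
        _ = _ := by field_simp
    have hI1 : Integrable (fun ω => 1 + (1 / τ) * clamp τ (Z i ω)) P :=
      (integrable_const 1).add (hcI.const_mul _)
    calc mgf (Y i) P (1 / τ)
        ≤ ∫ ω, Real.exp (-b / τ) *
          (1 + (1 / τ) * clamp τ (Z i ω) + (1 / τ ^ 2) * clamp τ (Z i ω) ^ 2) ∂P :=
          integral_mono_of_nonneg (ae_of_all _ fun _ => Real.exp_nonneg _)
            ((hI1.add (hcI2.const_mul _)).const_mul _) (ae_of_all _ h1)
      _ = Real.exp (-b / τ) * (1 + (1 / τ) * ∫ ω, clamp τ (Z i ω) ∂P +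
          (1 / τ ^ 2) * ∫ ω, clamp τ (Z i ω) ^ 2 ∂P) := by
          rw [integral_const_mul, integral_add hI1 (hcI2.const_mul _),
            integral_add (integrable_const 1) (hcI.const_mul _), integral_const_mul,
            integral_const_mul]
          simp
      _ ≤ Real.exp (-b / τ) * (1 + (1 / τ) * (b + V / τ) + (1 / τ ^ 2) * V) := by
          have h4 := (abs_le.1 (abs_integral_clamp_sub_le hτ (hZ i) (hb i) (hV i))).2
          have h5 := integral_clamp_sq_le hτ (hZ i) (hV i)
          gcongr
          linarith
      _ ≤ Real.exp (-b / τ) * Real.exp ((1 / τ) * (b + V / τ) + (1 / τ ^ 2) * V) := by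
          gcongr
          have := Real.add_one_le_exp ((1 / τ) * (b + V / τ) + (1 / τ ^ 2) * V)
          linarith
      _ = Real.exp (2 * V / τ ^ 2) := by
          rw [← Real.exp_add]
          congr 1
          field_simp
          ring
  rw [hYind.mgf_sum₀ hYm]
  calc Real.exp (-(1 / τ) * (n * s)) * ∏ i, mgf (Y i) P (1 / τ)
      ≤ Real.exp (-(1 / τ) * (n * s)) * ∏ _i : Fin n, Real.exp (2 * V / τ ^ 2) := by
        gcongr with i
        · exact fun i _ => mgf_nonneg
        · exact hmgf i
    _ = _ := by
        rw [Finset.prod_const, Finset.card_univ, Fintype.card_fin, ← Real.exp_nat_mul,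
          ← Real.exp_add]
        congr 1
        ring

/-- Deviation bound for the truncated mean. -/
lemma measureReal_abs_truncatedMean_sub_ge_le (hn : 0 < n) (hτ : 0 < τ) {Z : Fin n → Ω → ℝ}
    (hZ : ∀ i, MemLp (Z i) 2 P) (hind : iIndepFun Z P) (hb : ∀ i, ∫ ω, Z i ω ∂P = b)
    (hV : ∀ i, ∫ ω, Z i ω ^ 2 ∂P ≤ V) (s : ℝ) :
    P.real {ω | s ≤ |(1 / n : ℝ) * ∑ i, clamp τ (Z i ω) - b|} ≤
      2 * Real.exp (2 * n * V / τ ^ 2 - n * s / τ) := by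
  have h1 := measureReal_truncatedMean_sub_ge_le hn hτ hZ hind hb hV s
  -- Truncation is odd, so the lower tail is the upper tail for `-Z`.
  have h2 := measureReal_truncatedMean_sub_ge_le (b := -b) (V := V) hn hτ (Z := fun i ω => -Z i ω)
    (fun i => (hZ i).neg) (hind.comp (fun _ z => -z) fun _ => measurable_neg)
    (fun i => by rw [integral_neg, hb]) (fun i => by simpa using hV i) s
  have hsub : {ω | s ≤ |(1 / n : ℝ) * ∑ i, clamp τ (Z i ω) - b|} ⊆
      {ω | s ≤ (1 / n : ℝ) * ∑ i, clamp τ (Z i ω) - b} ∪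
        {ω | s ≤ (1 / n : ℝ) * ∑ i, clamp τ (-Z i ω) - -b} := fun ω hω => by
    rcases le_abs.1 (show s ≤ |(1 / n : ℝ) * ∑ i, clamp τ (Z i ω) - b| from hω) with h | h
    · exact Or.inl h
    · right
      simp only [Set.mem_ofPred_eq, clamp_neg, Finset.sum_neg_distrib]
      linarith
  calc _ ≤ _ := measureReal_mono hsub
    _ ≤ _ := measureReal_union_le _ _
    _ ≤ _ := by linarith

end Truncation

/-! ### The Stein estimator of the index -/

section SteinEstimator

variable {n d : ℕ} {m θ : EuclideanSpace ℝ (Fin d)} {Q : Matrix (Fin d) (Fin d) ℝ}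
  {f : ℝ → ℝ} {Lf Lf' σ M τ : ℝ}

/-- The average of the truncated vectors, which is the unique minimizer of the unregularized Stein
objective. -/
noncomputable def steinEstimator (S : EuclideanSpace ℝ (Fin d) → EuclideanSpace ℝ (Fin d)) (τ : ℝ)
    (x : Fin n → EuclideanSpace ℝ (Fin d)) (y : Fin n → ℝ) : EuclideanSpace ℝ (Fin d) :=
  (1 / n : ℝ) • ∑ i, trunc τ (y i • S (x i))

/-- Completing the square: without penalty the objective is `‖t - g‖² - ‖g‖²`, with `g` the mean of
the truncated vectors. -/
lemma eq_steinEstimator_of_isMinOn {S : EuclideanSpace ℝ (Fin d) → EuclideanSpace ℝ (Fin d)}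
    {x : Fin n → EuclideanSpace ℝ (Fin d)} {y : Fin n → ℝ} {θ : EuclideanSpace ℝ (Fin d)}
    (h : IsMinOn (steinObjective S τ 0 x y) Set.univ θ) : θ = steinEstimator S τ x y := by
  set g := steinEstimator S τ x y with hg
  have hobj : ∀ t, steinObjective S τ 0 x y t = ‖t - g‖ ^ 2 - ‖g‖ ^ 2 := fun t => by
    have e : (∑ i, inner ℝ (trunc τ (y i • S (x i))) t) =
        inner ℝ (∑ i, trunc τ (y i • S (x i))) t := (sum_inner _ _ _).symm
    rw [steinObjective, e, norm_sub_sq_real, real_inner_comm g t, hg, steinEstimator,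
      inner_smul_left]
    simp
    ring
  have h1 := isMinOn_univ_iff.1 h g
  rw [hobj, hobj, sub_self, norm_zero] at h1
  have h2 : ‖θ - g‖ ^ 2 ≤ 0 := by linarith
  have h3 : ‖θ - g‖ = 0 := by
    have := norm_nonneg (θ - g)
    nlinarith
  exact sub_eq_zero.1 (norm_eq_zero.1 h3)

lemma steinEstimator_apply (hQ : Q.PosDef) (x : Fin n → EuclideanSpace ℝ (Fin d)) (y : Fin n → ℝ)
    (j : Fin d) :
    steinEstimator (score (gaussianDensity m Q)) τ x y j =
      (1 / n : ℝ) * ∑ i, clamp τ (y i * inner ℝ (x i - m) (scoreVec Q j)) := by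
  simp [steinEstimator, trunc, clamp, score_apply hQ, Finset.sum_apply]

variable {Ω : Type*} [MeasurableSpace Ω] {P : Measure Ω} [IsProbabilityMeasure P]

/-- The noise is centred and independent of the design, so it drops out of the mean, which Stein's
identity evaluates, and out of the cross term of the square. Boundedness of `f` and independence
make the product square integrable without fourth moments. -/
lemma response_mul_inner_moments (hQ : Q.PosSemidef) (hf : ContDiff ℝ 1 f)
    (hfb : ∀ t, |f t| ≤ Lf) (hf' : ∀ t, |deriv f t| ≤ Lf') (hθ : sqrtMul Q θ ≠ 0)
    (v : EuclideanSpace ℝ (Fin d))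
    (hM : ∫ x, (inner ℝ (x - m) v) ^ 2 ∂multivariateGaussian m Q ≤ M)
    {X : Ω → EuclideanSpace ℝ (Fin d)} {η : Ω → ℝ} (hX : HasLaw X (multivariateGaussian m Q) P)
    (hη : MemLp η 2 P) (hη0 : ∫ ω, η ω ∂P = 0) (hησ : variance η P ≤ σ ^ 2)
    (hind : IndepFun X η P) :
    MemLp (fun ω => (f (inner ℝ (X ω) θ) + η ω) * inner ℝ (X ω - m) v) 2 P ∧
    ∫ ω, (f (inner ℝ (X ω) θ) + η ω) * inner ℝ (X ω - m) v ∂P =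
      (∫ x, deriv f (inner ℝ x θ) ∂multivariateGaussian m Q) *
        inner ℝ (sqrtMul Q θ) (sqrtMul Q v) ∧
    ∫ ω, ((f (inner ℝ (X ω) θ) + η ω) * inner ℝ (X ω - m) v) ^ 2 ∂P ≤ (σ ^ 2 + Lf ^ 2) * M := by
  have hfm : Measurable f := hf.continuous.measurable
  have hXm : AEMeasurable X P := hX.aemeasurable
  set s : Ω → ℝ := fun ω => inner ℝ (X ω - m) v with hs
  set g : Ω → ℝ := fun ω => f (inner ℝ (X ω) θ) with hg
  have hgm : AEMeasurable g P := hfm.comp_aemeasurable (by fun_prop)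
  have hsL : MemLp s 2 P := by
    have h := memLp_inner_sub (m := m) (Q := Q) v
    rw [← hX.map_eq] at h
    exact h.comp_of_map hXm
  have hsq : ∫ ω, s ω ^ 2 ∂P ≤ M := by
    refine le_of_eq_of_le ?_ hM
    exact hX.integral_comp (f := fun x => (inner ℝ (x - m) v : ℝ) ^ 2) (by fun_prop)
  have hsI := hsL.integrable (q := 2) (by norm_num)
  have hgb : ∀ᵐ ω ∂P, ‖g ω‖ ≤ Lf := ae_of_all _ fun ω => hfb _
  have hηI := hη.integrable (q := 2) (by norm_num)
  have hηsq : ∫ ω, η ω ^ 2 ∂P ≤ σ ^ 2 := by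
    rwa [variance_of_integral_eq_zero hη.aestronglyMeasurable.aemeasurable hη0] at hησ
  have ind1 : IndepFun s η P :=
    hind.comp (φ := fun x => inner ℝ (x - m) v) (ψ := id) (by fun_prop) measurable_id
  have ind2 : IndepFun (fun ω => s ω ^ 2) (fun ω => η ω ^ 2) P :=
    ind1.comp (φ := fun t => t ^ 2) (ψ := fun t => t ^ 2) (by fun_prop) (by fun_prop)
  have ind3 : IndepFun (fun ω => g ω * s ω ^ 2) η P :=
    hind.comp (φ := fun x => f (inner ℝ x θ) * inner ℝ (x - m) v ^ 2) (ψ := id)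
      (by fun_prop) measurable_id
  have hgs : Integrable (fun ω => g ω * s ω) P := hsI.bdd_mul hgm.aestronglyMeasurable hgb
  have hgss : Integrable (fun ω => g ω * s ω ^ 2) P :=
    hsL.integrable_sq.bdd_mul hgm.aestronglyMeasurable hgb
  have hggss : Integrable (fun ω => g ω ^ 2 * s ω ^ 2) P :=
    hsL.integrable_sq.bdd_mul (c := Lf ^ 2) (hgm.pow_const 2).aestronglyMeasurable
      (ae_of_all _ fun ω => by
        rw [Real.norm_eq_abs, abs_pow]
        exact pow_le_pow_left₀ (abs_nonneg _) (hfb _) 2)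
  have hsη : Integrable (fun ω => s ω * η ω) P := ind1.integrable_mul hsI hηI
  have hssη : Integrable (fun ω => g ω * s ω ^ 2 * η ω) P := ind3.integrable_mul hgss hηI
  have hssηη : Integrable (fun ω => s ω ^ 2 * η ω ^ 2) P :=
    ind2.integrable_mul hsL.integrable_sq hη.integrable_sq
  have hexp : ∀ ω, ((g ω + η ω) * s ω) ^ 2 =
      g ω ^ 2 * s ω ^ 2 + 2 * (g ω * s ω ^ 2 * η ω) + s ω ^ 2 * η ω ^ 2 := fun ω => by ring
  have hI1 : Integrable (fun ω => g ω ^ 2 * s ω ^ 2 + 2 * (g ω * s ω ^ 2 * η ω)) P :=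
    hggss.add (hssη.const_mul 2)
  refine ⟨?_, ?_, ?_⟩
  · change MemLp (fun ω => (g ω + η ω) * s ω) 2 P
    rw [memLp_two_iff_integrable_sq]
    · simp_rw [hexp]
      exact hI1.add hssηη
    · exact ((hgm.add hη.aestronglyMeasurable.aemeasurable).mul
        hsL.aestronglyMeasurable.aemeasurable).aestronglyMeasurable
  · have e : ∀ ω, (g ω + η ω) * s ω = g ω * s ω + s ω * η ω := fun ω => by ring
    change ∫ ω, (g ω + η ω) * s ω ∂P = _
    simp_rw [e]
    rw [integral_add hgs hsη, ind1.integral_fun_mul_eq_mul_integral hsI.aestronglyMeasurable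
      hηI.aestronglyMeasurable, hη0, mul_zero, add_zero, mul_comm,
      ← integral_comp_inner_mul_inner hQ hf hfb hf' θ v hθ]
    exact hX.integral_comp (f := fun x => f (inner ℝ x θ) * (inner ℝ (x - m) v : ℝ))
      (by fun_prop)
  · change ∫ ω, ((g ω + η ω) * s ω) ^ 2 ∂P ≤ _
    simp_rw [hexp]
    rw [integral_add hI1 hssηη, integral_add hggss (hssη.const_mul 2), integral_const_mul,
      ind3.integral_fun_mul_eq_mul_integral hgss.aestronglyMeasurable hηI.aestronglyMeasurable,
      ind2.integral_fun_mul_eq_mul_integral hsL.integrable_sq.aestronglyMeasurable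
        hη.integrable_sq.aestronglyMeasurable, hη0]
    have h0 : 0 ≤ ∫ ω, s ω ^ 2 ∂P := integral_nonneg fun _ => sq_nonneg _
    have h1 : ∫ ω, g ω ^ 2 * s ω ^ 2 ∂P ≤ Lf ^ 2 * ∫ ω, s ω ^ 2 ∂P := by
      rw [← integral_const_mul]
      refine integral_mono hggss (hsL.integrable_sq.const_mul _) fun ω => ?_
      have : g ω ^ 2 ≤ Lf ^ 2 := sq_le_sq' (by linarith [(abs_le.1 (hfb (inner ℝ (X ω) θ))).1])
        (abs_le.1 (hfb _)).2
      exact mul_le_mul_of_nonneg_right this (sq_nonneg _)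
    have h2 : (∫ ω, s ω ^ 2 ∂P) * ∫ ω, η ω ^ 2 ∂P ≤ (∫ ω, s ω ^ 2 ∂P) * σ ^ 2 :=
      mul_le_mul_of_nonneg_left hηsq h0
    have h3 : (σ ^ 2 + Lf ^ 2) * ∫ ω, s ω ^ 2 ∂P ≤ (σ ^ 2 + Lf ^ 2) * M := by gcongr
    linarith

variable {x : Fin n → Ω → EuclideanSpace ℝ (Fin d)} {η : Fin n → Ω → ℝ}

/-- Mean squared error and deviation of the Stein estimator. -/
lemma steinEstimator_error (hn : 0 < n) (hτ : 0 < τ) (hQ : Q.PosDef) (hf : ContDiff ℝ 1 f)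
    (hfb : ∀ t, |f t| ≤ Lf) (hf' : ∀ t, |deriv f t| ≤ Lf') (hθ : sqrtMul Q θ ≠ 0)
    (hM : ∀ j, ∫ x, (score (gaussianDensity m Q) x j) ^ 2 ∂(multivariateGaussian m Q) ≤ M)
    (hx : ∀ i, HasLaw (x i) (multivariateGaussian m Q) P)
    (hη : ∀ i, MemLp (η i) 2 P ∧ ∫ ω, η i ω ∂P = 0 ∧ variance (η i) P ≤ σ ^ 2)
    (hxη : ∀ i, IndepFun (x i) (η i) P) (hind : iIndepFun (fun i ω => (x i ω, η i ω)) P)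
    {μ V : ℝ} (hμ : μ = ∫ x, deriv f (inner ℝ x θ) ∂multivariateGaussian m Q)
    (hV : V = (σ ^ 2 + Lf ^ 2) * M) {Δ : Ω → EuclideanSpace ℝ (Fin d)}
    (hΔ : ∀ ω, Δ ω = steinEstimator (score (gaussianDensity m Q)) τ (fun i => x i ω)
      (fun i => f (inner ℝ (x i ω) θ) + η i ω) - μ • θ) :
    (∫⁻ ω, ENNReal.ofReal ‖Δ ω‖ ∂P ≤ ENNReal.ofReal √(d * (V / n + (V / τ) ^ 2))) ∧
    ∀ s : ℝ, 0 ≤ s → P.real {ω | √d * s < ‖Δ ω‖} ≤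
      d * (2 * Real.exp (2 * n * V / τ ^ 2 - n * s / τ)) := by
  set Z : Fin d → Fin n → Ω → ℝ := fun j i ω =>
    (f (inner ℝ (x i ω) θ) + η i ω) * inner ℝ (x i ω - m) (scoreVec Q j) with hZdef
  have hfm : Measurable f := hf.continuous.measurable
  have hmom := fun j i => response_mul_inner_moments (M := M) hQ.posSemidef hf hfb hf' hθ
    (scoreVec Q j) (by simpa only [score_apply hQ] using hM j) (hx i) (hη i).1 (hη i).2.1
    (hη i).2.2 (hxη i)
  have hZL : ∀ j i, MemLp (Z j i) 2 P := fun j i => (hmom j i).1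
  have hZb : ∀ j i, ∫ ω, Z j i ω ∂P = μ * θ j := fun j i => by
    rw [(hmom j i).2.1, inner_sqrtMul_scoreVec hQ, hμ]
  have hZV : ∀ j i, ∫ ω, Z j i ω ^ 2 ∂P ≤ V := fun j i => hV ▸ (hmom j i).2.2
  have hZind : ∀ j, iIndepFun (Z j) P := fun j =>
    hind.comp (fun _ z => (f (inner ℝ z.1 θ) + z.2) * inner ℝ (z.1 - m) (scoreVec Q j))
      fun _ => by fun_prop
  have hΔj : ∀ ω j, Δ ω j = (1 / n : ℝ) * ∑ i, clamp τ (Z j i ω) - μ * θ j := fun ω j => by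
    rw [hΔ, PiLp.sub_apply, steinEstimator_apply hQ]
    simp [hZdef]
  have hΔjL : ∀ j, MemLp (fun ω => Δ ω j) 2 P := fun j => by
    simp_rw [hΔj]
    exact ((memLp_finsetSum _ fun i _ => memLp_clamp hτ
      (hZL j i).aestronglyMeasurable.aemeasurable 2).const_mul _).sub (memLp_const _)
  have hnorm : ∀ ω, ‖Δ ω‖ ^ 2 = ∑ j, Δ ω j ^ 2 := fun ω => EuclideanSpace.real_norm_sq_eq _
  have hΔm : AEMeasurable Δ P := by
    have : AEMeasurable (fun ω => (Δ ω).ofLp) P :=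
      aemeasurable_pi_lambda _ fun j => (hΔjL j).aestronglyMeasurable.aemeasurable
    exact (WithLp.measurable_toLp 2 (Fin d → ℝ)).comp_aemeasurable this
  constructor
  · have hL : MemLp (fun ω => ‖Δ ω‖) 2 P := by
      rw [memLp_two_iff_integrable_sq hΔm.norm.aestronglyMeasurable]
      simp_rw [hnorm]
      exact integrable_finsetSum _ fun j _ => (hΔjL j).integrable_sq
    have hV0 : 0 ≤ d * (V / n + (V / τ) ^ 2) := by
      rcases Nat.eq_zero_or_pos d with h0 | h0
      · simp [h0]
      · have : 0 ≤ V := le_trans (integral_nonneg fun _ => sq_nonneg _) (hZV ⟨0, h0⟩ ⟨0, hn⟩)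
        positivity
    have := lintegral_ofReal_abs_le hL (Real.sqrt_nonneg (d * (V / n + (V / τ) ^ 2))) (by
      rw [Real.sq_sqrt hV0]
      simp_rw [hnorm]
      rw [integral_finsetSum _ fun j _ => (hΔjL j).integrable_sq]
      simp_rw [hΔj]
      refine (Finset.sum_le_sum fun j _ => integral_truncatedMean_sub_sq_le hn hτ (hZL j) (hZind j)
        (hZb j) (hZV j)).trans ?_
      simp [mul_add])
    simpa using this
  · intro s hs
    -- If all coordinates are below `s`, the norm is at most `√d s`; a union bound over the
    -- coordinates follows.
    have hsub : {ω | √d * s < ‖Δ ω‖} ⊆ ⋃ j, {ω | s ≤ |Δ ω j|} := fun ω hω => by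
      by_contra hcon
      simp only [Set.mem_iUnion, Set.mem_ofPred_eq, not_exists, not_le] at hcon
      have h1 : ‖Δ ω‖ ^ 2 ≤ (√d * s) ^ 2 := by
        rw [hnorm, mul_pow, Real.sq_sqrt (Nat.cast_nonneg d)]
        calc ∑ j, Δ ω j ^ 2 ≤ ∑ _j : Fin d, s ^ 2 := Finset.sum_le_sum fun j _ => by
              rw [← sq_abs]; exact pow_le_pow_left₀ (abs_nonneg _) (hcon j).le 2
          _ = d * s ^ 2 := by simp
      exact absurd (abs_le_of_sq_le_sq' h1 (by positivity)).2 (not_le.2 hω)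
    refine (measureReal_mono hsub).trans ((measureReal_iUnion_fintype_le _).trans ?_)
    calc _ ≤ ∑ _j : Fin d, 2 * Real.exp (2 * n * V / τ ^ 2 - n * s / τ) :=
          Finset.sum_le_sum fun j _ => by
            simp_rw [hΔj]
            exact measureReal_abs_truncatedMean_sub_ge_le hn hτ (hZL j) (hZind j) (hZb j)
              (hZV j) s
      _ = _ := by simp

end SteinEstimator

/-! ### Eigenvalue bound and comparison of norms -/

section LinearAlgebra

variable {d : ℕ} {Q : Matrix (Fin d) (Fin d) ℝ}

/-- In an eigenbasis `b` of `Q`, `‖Q^{1/2} v‖² = ⟨v, Q v⟩ = ∑ λᵢ ⟨bᵢ, v⟩²`. -/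
lemma norm_sqrtMul_le (hQ : Q.PosDef) {K : ℝ}
    (hK : ∀ j, hQ.isHermitian.eigenvalues j ≤ K) (v : EuclideanSpace ℝ (Fin d)) :
    ‖sqrtMul Q v‖ ≤ √K * ‖v‖ := by
  have hsym : Qᵀ = Q := by
    have := hQ.isHermitian.eq
    rwa [Matrix.conjTranspose_eq_transpose_of_trivial] at this
  set b := hQ.isHermitian.eigenvectorBasis with hb
  have h1 : ∀ i, inner ℝ (b i) (WithLp.toLp 2 (Q *ᵥ v.ofLp)) =
      hQ.isHermitian.eigenvalues i * inner ℝ (b i) v := fun i => by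
    rw [inner_eq_dotProduct, inner_eq_dotProduct]
    simp only
    rw [Matrix.dotProduct_mulVec, ← Matrix.mulVec_transpose, hsym, hb,
      hQ.isHermitian.mulVec_eigenvectorBasis, smul_dotProduct]
    rfl
  have h2 : ‖sqrtMul Q v‖ ^ 2 ≤ K * ‖v‖ ^ 2 := by
    rw [← real_inner_self_eq_norm_sq, inner_sqrtMul hQ.posSemidef,
      ← b.sum_sq_inner_right v, Finset.mul_sum]
    have e : v.ofLp ⬝ᵥ Q *ᵥ v.ofLp = inner ℝ v (WithLp.toLp 2 (Q *ᵥ v.ofLp)) := by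
      rw [inner_eq_dotProduct]
    rw [e, ← b.sum_inner_mul_inner]
    refine Finset.sum_le_sum fun i _ => ?_
    rw [h1, real_inner_comm]
    have := mul_le_mul_of_nonneg_right (hK i) (sq_nonneg (inner ℝ (b i) v))
    nlinarith
  rcases Nat.eq_zero_or_pos d with h0 | h0
  · subst h0
    rw [Subsingleton.elim v 0, Subsingleton.elim (sqrtMul Q 0) 0]; simp
  have hK0 : 0 ≤ K := (hQ.eigenvalues_pos ⟨0, h0⟩).le.trans (hK ⟨0, h0⟩)
  refine (abs_le_of_sq_le_sq' ?_ (by positivity)).2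
  rwa [mul_pow, Real.sq_sqrt hK0]

lemma eq_zero_of_sqrtMul_eq_zero (hQ : Q.PosDef) {v : EuclideanSpace ℝ (Fin d)}
    (hv : sqrtMul Q v = 0) : v = 0 := by
  by_contra h
  have h1 : v.ofLp ≠ 0 := fun h0 => h (by ext j; simp [h0])
  have h2 := hQ.dotProduct_mulVec_pos h1
  have h3 := inner_sqrtMul hQ.posSemidef v v
  rw [hv, inner_zero_left] at h3
  simp only [star_trivial] at h2
  linarith

lemma l1norm_nonneg (v : EuclideanSpace ℝ (Fin d)) : 0 ≤ l1norm v :=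
  Finset.sum_nonneg fun _ _ => abs_nonneg _

lemma l1norm_add_le (u v : EuclideanSpace ℝ (Fin d)) : l1norm (u + v) ≤ l1norm u + l1norm v := by
  simp only [l1norm, ← Finset.sum_add_distrib]
  exact Finset.sum_le_sum fun j _ => abs_add_le _ _

lemma l1norm_smul (c : ℝ) (v : EuclideanSpace ℝ (Fin d)) : l1norm (c • v) = |c| * l1norm v := by
  simp [l1norm, Finset.mul_sum, abs_mul]

lemma l1norm_eq_zero {v : EuclideanSpace ℝ (Fin d)} (h : l1norm v = 0) : v = 0 := by
  ext j
  have := (Finset.sum_eq_zero_iff_of_nonneg fun j _ => abs_nonneg (v j)).1 h j (Finset.mem_univ j)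
  simpa using this

lemma l1norm_le_sqrt_mul_norm (v : EuclideanSpace ℝ (Fin d)) : l1norm v ≤ √d * ‖v‖ := by
  refine (abs_le_of_sq_le_sq' ?_ (by positivity)).2
  rw [mul_pow, Real.sq_sqrt (Nat.cast_nonneg d), EuclideanSpace.real_norm_sq_eq]
  have := sq_sum_le_card_mul_sum_sq (s := Finset.univ) (f := fun j => |v j|)
  simpa [l1norm] using this

lemma norm_le_l1norm (v : EuclideanSpace ℝ (Fin d)) : ‖v‖ ≤ l1norm v := by
  refine (abs_le_of_sq_le_sq' ?_ (l1norm_nonneg v)).2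
  rw [EuclideanSpace.real_norm_sq_eq]
  have := Finset.sum_sq_le_sq_sum_of_nonneg (s := Finset.univ) (f := fun j => |v j|)
    fun j _ => abs_nonneg (v j)
  simpa [l1norm] using this

end LinearAlgebra

/-! ### Measurability of the estimators and of the error -/

section Measurability

variable {n d : ℕ} {m θ : EuclideanSpace ℝ (Fin d)} {Q : Matrix (Fin d) (Fin d) ℝ} {f : ℝ → ℝ}

lemma measurable_normalize : Measurable (normalize Q) := by
  have h1 : Measurable fun v : EuclideanSpace ℝ (Fin d) => l1norm v := by
    unfold l1norm; fun_prop
  have h2 : Measurable fun v : EuclideanSpace ℝ (Fin d) => (l1norm (sqrtMul Q v))⁻¹ :=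
    (h1.comp measurable_sqrtMul).inv
  exact h2.smul measurable_id

lemma measurable_steinEstimator (hQ : Q.PosDef) {τ : ℝ} (hτ : 0 < τ) :
    Measurable fun z : (Fin n → EuclideanSpace ℝ (Fin d)) × (Fin n → ℝ) =>
      steinEstimator (score (gaussianDensity m Q)) τ z.1 z.2 := by
  have h : Measurable fun z : (Fin n → EuclideanSpace ℝ (Fin d)) × (Fin n → ℝ) =>
      (steinEstimator (score (gaussianDensity m Q)) τ z.1 z.2).ofLp := by
    refine measurable_pi_lambda _ fun j => ?_
    simp_rw [steinEstimator_apply hQ]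
    have := measurable_clamp hτ
    fun_prop
  exact (WithLp.measurable_toLp 2 (Fin d → ℝ)).comp h

lemma measurable_uniformKernel (h : ℝ) : Measurable (uniformKernel h) := by
  unfold uniformKernel
  exact Measurable.ite (measurableSet_le (by fun_prop) (by fun_prop)) measurable_const
    measurable_const

lemma measurable_predictionError (hf : Measurable f) :
    Measurable fun z : EuclideanSpace ℝ (Fin d) × (Fin n → EuclideanSpace ℝ (Fin d)) ×
      (Fin n → ℝ) × EuclideanSpace ℝ (Fin d) =>
        predictionError f θ m z.1 z.2.1 z.2.2.1 z.2.2.2 := by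
  unfold predictionError kernelRegression
  have hk := measurable_uniformKernel ((n : ℝ) ^ (-(1 : ℝ) / 3))
  refine ((Measurable.ite (measurableSet_le ?_ measurable_const) ?_ measurable_const).sub
    ?_).abs
  · fun_prop
  · fun_prop
  · fun_prop

end Measurability

/-! ### From the sample space to product measures -/

section Transfer

variable {Ω : Type*} [MeasurableSpace Ω] {P : Measure Ω} [IsProbabilityMeasure P]

lemma integrable_and_integral_le {P : Measure Ω} {g : Ω → ℝ} (hg : AEMeasurable g P)
    (h0 : 0 ≤ g) {c : ℝ} (hc : 0 ≤ c) (h : ∫⁻ ω, ENNReal.ofReal (g ω) ∂P ≤ ENNReal.ofReal c) :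
    Integrable g P ∧ ∫ ω, g ω ∂P ≤ c := by
  refine ⟨⟨hg.aestronglyMeasurable, ?_⟩, ?_⟩
  · rw [hasFiniteIntegral_iff_ofReal (ae_of_all _ h0)]
    exact h.trans_lt ENNReal.ofReal_lt_top
  · rw [integral_eq_lintegral_of_nonneg_ae (ae_of_all _ h0) hg.aestronglyMeasurable]
    exact ENNReal.toReal_le_of_le_ofReal hc h

/-- Fubini, with the first batch kept as the outer variable. A function `G` that ignores its first
argument gives the expectation at a frozen first batch; a general `G` gives the full expectation. -/
lemma lintegral_prod_batches {ι ι' α β : Type*} [Fintype ι] [Fintype ι'] [MeasurableSpace α]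
    [MeasurableSpace β] {Y : ι ⊕ ι' → Ω → α} {X : Ω → β} (μ : ι ⊕ ι' → Measure α) {D : Measure β}
    [∀ i, IsProbabilityMeasure (μ i)] [IsProbabilityMeasure D]
    (hY : ∀ i, HasLaw (Y i) (μ i) P) (hind : iIndepFun Y P) (hX : HasLaw X D P)
    (hXY : IndepFun X (fun ω i => Y i ω) P) {G : (ι → α) × (ι' → α) × β → ENNReal}
    (hG : Measurable G) :
    ∫⁻ ω, G (fun i => Y (Sum.inl i) ω, fun i => Y (Sum.inr i) ω, X ω) ∂P =
      ∫⁻ ω, ∫⁻ u, ∫⁻ z, G (fun i => Y (Sum.inl i) ω, z, u)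
        ∂Measure.pi (fun i => μ (Sum.inr i)) ∂D ∂P := by
  have hall : HasLaw (fun ω i => Y i ω) (Measure.pi μ) P := hind.hasLaw_pi hY
  have hjoint := hXY.hasLaw_prod hX hall
  have hfst : HasLaw (fun ω i => Y (Sum.inl i) ω) (Measure.pi fun i => μ (Sum.inl i)) P :=
    iIndepFun.hasLaw_pi (fun i => hY (Sum.inl i)) (hind.precomp Sum.inl_injective)
  have hsplit := (measurePreserving_sumPiEquivProdPi_symm (X := fun _ : ι ⊕ ι' => α) μ)
  have hG1 : Measurable fun w : β × (ι ⊕ ι' → α) =>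
      G (fun i => w.2 (Sum.inl i), fun i => w.2 (Sum.inr i), w.1) := by fun_prop
  have hG2 : Measurable fun w : (ι → α) × β => ∫⁻ z, G (w.1, z, w.2)
      ∂Measure.pi (fun i => μ (Sum.inr i)) := by
    have : Measurable fun q : ((ι → α) × β) × (ι' → α) => G (q.1.1, q.2, q.1.2) := by fun_prop
    exact this.lintegral_prod_right'
  have hG3 : Measurable fun w : ι → α => ∫⁻ u, ∫⁻ z, G (w, z, u)
      ∂Measure.pi (fun i => μ (Sum.inr i)) ∂D := hG2.lintegral_prod_right'
  rw [hfst.lintegral_comp hG3.aemeasurable, hjoint.lintegral_comp hG1.aemeasurable,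
    lintegral_prod _ hG1.aemeasurable]
  have hstep : ∀ u, ∫⁻ y, G (fun i => y (Sum.inl i), fun i => y (Sum.inr i), u) ∂Measure.pi μ =
      ∫⁻ w, ∫⁻ z, G (w, z, u) ∂Measure.pi (fun i => μ (Sum.inr i))
        ∂Measure.pi (fun i => μ (Sum.inl i)) := fun u => by
    have hGu : Measurable fun y : ι ⊕ ι' → α =>
      G (fun i => y (Sum.inl i), fun i => y (Sum.inr i), u) := by fun_prop
    have hGp : Measurable fun a : (ι → α) × (ι' → α) => G (a.1, a.2, u) := by fun_prop
    rw [← hsplit.lintegral_comp hGu]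
    exact lintegral_prod _ hGp.aemeasurable
  simp_rw [hstep]
  rw [lintegral_lintegral_swap]
  exact (hG2.comp measurable_swap).aemeasurable

lemma lintegral_pi_prod {ι α β : Type*} [Fintype ι] [MeasurableSpace α] [MeasurableSpace β]
    (μ : ι → Measure α) (ν : ι → Measure β) [∀ i, IsProbabilityMeasure (μ i)]
    [∀ i, IsProbabilityMeasure (ν i)] {G : (ι → α × β) → ENNReal} (hG : Measurable G) :
    ∫⁻ z, G z ∂Measure.pi (fun i => (μ i).prod (ν i)) =
      ∫⁻ x, ∫⁻ y, G (fun i => (x i, y i)) ∂Measure.pi ν ∂Measure.pi μ := by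
  have h := (measurePreserving_arrowProdEquivProdArrow α β ι μ ν)
  have hG' : Measurable fun w : (ι → α) × (ι → β) => G (fun i => (w.1 i, w.2 i)) := by fun_prop
  rw [← lintegral_prod _ hG'.aemeasurable, ← h.lintegral_comp hG']
  rfl

end Transfer

/-! ### Rates in terms of the bandwidth -/

section Rates

variable {n d : ℕ}

lemma bandwidth_pos (hn : 0 < n) : 0 < (n : ℝ) ^ (-(1 : ℝ) / 3) :=
  Real.rpow_pos_of_pos (by exact_mod_cast hn) _

lemma bandwidth_le_one (hn : 0 < n) : (n : ℝ) ^ (-(1 : ℝ) / 3) ≤ 1 :=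
  Real.rpow_le_one_of_one_le_of_nonpos (by exact_mod_cast hn) (by norm_num)

lemma natCast_mul_bandwidth_pow_three (hn : 0 < n) :
    (n : ℝ) * ((n : ℝ) ^ (-(1 : ℝ) / 3)) ^ 3 = 1 := by
  have hn' : (0 : ℝ) < n := by exact_mod_cast hn
  rw [← Real.rpow_natCast, ← Real.rpow_mul hn'.le]
  norm_num
  rw [Real.rpow_neg_one, mul_inv_cancel₀ hn'.ne']

/-- The bandwidth satisfies `n h³ = 1`, which balances the noise level `(n h)^{-1/2}` with the
smoothing bias `h`. -/
lemma inv_sqrt_natCast_mul_bandwidth (hn : 0 < n) :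
    1 / √(n * (n : ℝ) ^ (-(1 : ℝ) / 3)) = (n : ℝ) ^ (-(1 : ℝ) / 3) := by
  have hh := bandwidth_pos hn
  have h3 := natCast_mul_bandwidth_pow_three hn
  set h := (n : ℝ) ^ (-(1 : ℝ) / 3)
  have e : (n : ℝ) * h = (1 / h) ^ 2 := by field_simp; linarith
  rw [e, Real.sqrt_sq (by positivity), one_div_one_div]

/-- The left side is `n^{-2}`. -/
lemma exp_neg_truncation_sq_le (hn : 0 < n) :
    Real.exp (-(2 * √(Real.log n)) ^ 2 / 2) ≤ (n : ℝ) ^ (-(1 : ℝ) / 3) := by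
  have hn' : (1 : ℝ) ≤ n := by exact_mod_cast hn
  have hl := Real.log_nonneg hn'
  rw [mul_pow, Real.sq_sqrt hl, Real.rpow_def_of_pos (by linarith)]
  refine Real.exp_le_exp.2 ?_
  linarith

/-- By `n h³ = 1`, `(d h)⁶ ≤ A n h⁶ = A h³`, and `h ≤ 1`. -/
lemma dim_mul_bandwidth_le (hn : 0 < n) {A : ℝ} (h : (d : ℝ) ^ 6 ≤ A * n) :
    d * (n : ℝ) ^ (-(1 : ℝ) / 3) ≤ max A 1 := by
  have hh := bandwidth_pos hn
  have h3 := natCast_mul_bandwidth_pow_three hn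
  have h1 := bandwidth_le_one hn
  set b := (n : ℝ) ^ (-(1 : ℝ) / 3)
  have hA : 1 ≤ max A 1 := le_max_right _ _
  refine le_of_pow_le_pow_left₀ (n := 6) (by norm_num) (by positivity) ?_
  calc (d * b) ^ 6 = d ^ 6 * b ^ 6 := by ring
    _ ≤ (A * n) * b ^ 6 := by gcongr
    _ = A * b ^ 3 * (n * b ^ 3) := by ring
    _ = A * b ^ 3 := by rw [h3, mul_one]
    _ ≤ max A 1 * 1 := by
        gcongr
        · exact le_max_left _ _
        · exact pow_le_one₀ hh.le h1
    _ = max A 1 ^ 1 := by ring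
    _ ≤ max A 1 ^ 6 := pow_le_pow_right₀ hA (by norm_num)

/-- The ratio of the second moment bound to the truncation level is of the order of the
bandwidth. -/
lemma moment_div_truncation_le (hn : 0 < n) (hd : 0 < d) {A B V δ τ : ℝ} (hV : 0 < V)
    (hδ : 0 < δ) (hδ1 : δ < 1) (hB : Real.log (1 / δ) ≤ B * (n : ℝ) ^ ((1 : ℝ) / 3))
    (hA : d * (n : ℝ) ^ (-(1 : ℝ) / 3) ≤ A)
    (hτ : τ = √(3 * V * n / Real.log (2 * d / δ))) :
    0 < τ ∧ n * V / τ ^ 2 = Real.log (2 * d / δ) / 3 ∧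
      V / τ ≤ √(V * (2 * A + B) / 3) * (n : ℝ) ^ (-(1 : ℝ) / 3) := by
  have hn' : (0 : ℝ) < n := by exact_mod_cast hn
  have hd' : (1 : ℝ) ≤ d := by exact_mod_cast hd
  have hh := bandwidth_pos hn
  have h3 := natCast_mul_bandwidth_pow_three hn
  have hinv : (n : ℝ) ^ ((1 : ℝ) / 3) = ((n : ℝ) ^ (-(1 : ℝ) / 3))⁻¹ := by
    rw [← Real.rpow_neg hn'.le]; norm_num
  rw [hinv] at hB
  set h := (n : ℝ) ^ (-(1 : ℝ) / 3)
  set l := Real.log (2 * d / δ) with hl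
  have hl0 : 0 < l := Real.log_pos (by rw [lt_div_iff₀ hδ]; linarith)
  have hτ0 : 0 < τ := by rw [hτ]; exact Real.sqrt_pos.2 (by positivity)
  have hτ2 : τ ^ 2 = 3 * V * n / l := by rw [hτ, Real.sq_sqrt (by positivity)]
  -- Split `l = log(2d) + log(1/δ)`: the first part is at most `2d`, with `d h` bounded, and the
  -- second at most `B / h`.
  have hlh : l * h ≤ 2 * A + B := by
    have e : l = Real.log (2 * d) + Real.log (1 / δ) := by
      rw [← Real.log_mul (by positivity) (by positivity), hl]; congr 1; ring
    have h4 : Real.log (2 * d) ≤ 2 * d := (Real.log_le_sub_one_of_pos (by positivity)).trans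
      (by linarith)
    calc l * h ≤ (2 * d + B * h⁻¹) * h := by rw [e]; gcongr
      _ = 2 * (d * h) + B := by field_simp
      _ ≤ _ := by linarith
  refine ⟨hτ0, ?_, ?_⟩
  · rw [hτ2]; field_simp
  · have h0 : 0 ≤ V * (2 * A + B) / 3 := by
      have : 0 < 2 * A + B := lt_of_lt_of_le (by positivity) hlh
      positivity
    refine (abs_le_of_sq_le_sq' ?_ (by positivity)).2
    rw [mul_pow, Real.sq_sqrt h0, div_pow, hτ2]
    -- `(V/τ)² = V l / (3n)` and `1/n = h³`; one factor `h` is spent on `l`, leaving `h²`.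
    have e : V ^ 2 / (3 * V * n / l) = V * (l * h) / 3 * h ^ 2 := by
      have : (n : ℝ)⁻¹ = h ^ 3 := by
        rw [inv_eq_iff_eq_inv]; field_simp; linarith
      calc V ^ 2 / (3 * V * n / l) = V * l / 3 * (n : ℝ)⁻¹ := by field_simp
        _ = _ := by rw [this]; ring
    rw [e]
    gcongr

lemma sqrt_meanSquare_le (hn : 0 < n) {V ρ R : ℝ} (hV : 0 ≤ V) (hρ0 : 0 ≤ ρ)
    (hρ : ρ ≤ R * (n : ℝ) ^ (-(1 : ℝ) / 3)) :
    √(d * (V / n + ρ ^ 2)) ≤ √(V + R ^ 2) * (√d * (n : ℝ) ^ (-(1 : ℝ) / 3)) := by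
  have hn' : (0 : ℝ) < n := by exact_mod_cast hn
  have hh := bandwidth_pos hn
  have hh1 := bandwidth_le_one hn
  have hh3 := natCast_mul_bandwidth_pow_three hn
  set h := (n : ℝ) ^ (-(1 : ℝ) / 3)
  have e : √(V + R ^ 2) * (√d * h) = √(d * ((V + R ^ 2) * h ^ 2)) := by
    rw [Real.sqrt_mul (by positivity), Real.sqrt_mul (by positivity), Real.sqrt_sq hh.le]
    ring
  rw [e]
  refine Real.sqrt_le_sqrt ?_
  rw [add_mul]
  have h1 : V / n ≤ V * h ^ 2 := by
    have h0 : n * h ^ 3 ≤ n * h ^ 2 :=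
      mul_le_mul_of_nonneg_left (pow_le_pow_of_le_one hh.le hh1 (by norm_num)) hn'.le
    rw [div_le_iff₀ hn', mul_assoc]
    exact le_mul_of_one_le_right hV (by linarith)
  have h2 : ρ ^ 2 ≤ R ^ 2 * h ^ 2 := by
    rw [← mul_pow]
    exact pow_le_pow_left₀ hρ0 hρ 2
  gcongr

end Rates

/-! ### Plugging in the normalized estimate -/

/-- The constant in the mean prediction error bound in terms of the error of the index. -/
noncomputable def errorConst (Lf Lf' σ Cmax μ₀ A : ℝ) : ℝ :=
  2 * Lf + Lf' + Lf' * (√Cmax / μ₀) * (2 * A + 3) + 12 * (Lf + σ) * Real.exp (A ^ 2 / 4)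

section Plugin

variable {n d : ℕ} {m θ : EuclideanSpace ℝ (Fin d)} {Q : Matrix (Fin d) (Fin d) ℝ}
  {f : ℝ → ℝ} {Lf Lf' σ Cmax μ₀ A μ : ℝ}

/-- Mean prediction error when the direction is a normalized estimate of `μ • θ`. -/
lemma lintegral_predictionError_normalize_le (hn : 0 < n) (hd : 0 < d) (hQ : Q.PosDef)
    (hQC : ∀ j, hQ.isHermitian.eigenvalues j ≤ Cmax) (hf : ContDiff ℝ 1 f)
    (hfb : ∀ t, |f t| ≤ Lf) (hf' : ∀ t, |deriv f t| ≤ Lf')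
    (hA : d * (n : ℝ) ^ (-(1 : ℝ) / 3) ≤ A) (hθ : l1norm (sqrtMul Q θ) = 1)
    (hμ₀ : 0 < μ₀) (hμ : μ₀ ≤ μ)
    (ν : Fin n → Measure ℝ) [∀ i, IsProbabilityMeasure (ν i)]
    (h2 : ∀ i, MemLp id 2 (ν i)) (h0 : ∀ i, ∫ t, t ∂ν i = 0) (hσ : 0 ≤ σ)
    (hv : ∀ i, variance id (ν i) ≤ σ ^ 2) (θhat : EuclideanSpace ℝ (Fin d)) :
    ∫⁻ u, ∫⁻ x, ∫⁻ ε, ENNReal.ofReal (predictionError f θ m (normalize Q θhat) x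
        (fun i => f (inner ℝ (x i) θ) + ε i) u) ∂Measure.pi ν
        ∂Measure.pi (fun _ => multivariateGaussian m Q) ∂multivariateGaussian m Q ≤
      ENNReal.ofReal (errorConst Lf Lf' σ Cmax μ₀ A *
        ((n : ℝ) ^ (-(1 : ℝ) / 3) + ‖θhat - μ • θ‖)) := by
  have hLf : 0 ≤ Lf := (abs_nonneg _).trans (hfb 0)
  have hLf' : 0 ≤ Lf' := (abs_nonneg _).trans (hf' 0)
  have hn' : (0 : ℝ) < n := by exact_mod_cast hn
  have hd' : (1 : ℝ) ≤ d := by exact_mod_cast hd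
  have hh := bandwidth_pos hn
  have hh1 := bandwidth_le_one hn
  have hsq := inv_sqrt_natCast_mul_bandwidth hn
  have hW := exp_neg_truncation_sq_le hn
  unfold predictionError
  set h := (n : ℝ) ^ (-(1 : ℝ) / 3)
  have hμp : 0 < μ := hμ₀.trans_le hμ
  have hA0 : 0 ≤ A := le_trans (by positivity) hA
  have hsd : √d * h ≤ A := by
    refine le_trans ?_ hA
    gcongr
    exact Real.sqrt_le_iff.2 ⟨by positivity, by nlinarith⟩
  set Δ := θhat - μ • θ with hΔ
  set a := l1norm (sqrtMul Q θhat) with ha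
  have ha0 : 0 ≤ a := l1norm_nonneg _
  have hΔn : ‖sqrtMul Q Δ‖ ≤ √Cmax * ‖Δ‖ := norm_sqrtMul_le hQ hQC Δ
  have haμ : a ≤ μ + √d * (√Cmax * ‖Δ‖) := by
    have e : sqrtMul Q θhat = μ • sqrtMul Q θ + sqrtMul Q Δ := by
      rw [← sqrtMul_smul, ← sqrtMul_add, hΔ]; simp
    rw [ha, e]
    refine (l1norm_add_le _ _).trans ?_
    rw [l1norm_smul, hθ, mul_one, abs_of_pos hμp]
    gcongr
    exact (l1norm_le_sqrt_mul_norm _).trans (by gcongr)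
  -- This gives `κ = a/μ` and `e = Δ/μ`. It also holds for `a = 0`, since then `θhat = 0` by
  -- positive definiteness.
  have hdec : θ = (a / μ) • normalize Q θhat - (1 / μ) • Δ := by
    have e1 : a • normalize Q θhat = θhat := by
      by_cases h0 : a = 0
      · rw [h0, zero_smul, eq_zero_of_sqrtMul_eq_zero hQ (l1norm_eq_zero h0)]
      · rw [normalize, ← ha, smul_inv_smul₀ h0]
    have e2 : (a / μ) • normalize Q θhat = (1 / μ) • θhat := by
      rw [show a / μ = 1 / μ * a by ring, mul_smul, e1]
    rw [e2, ← smul_sub, hΔ, sub_sub_cancel, smul_smul, one_div_mul_cancel hμp.ne', one_smul]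
  have hsn : a = 0 ∨ l1norm (sqrtMul Q (normalize Q θhat)) = 1 := by
    by_cases h0 : a = 0
    · exact Or.inl h0
    · right
      rw [normalize, ← ha, sqrtMul_smul, l1norm_smul, ← ha, abs_of_nonneg (by positivity),
        inv_mul_cancel₀ h0]
  have hϑ0 : a = 0 → normalize Q θhat = 0 := fun h0 => by rw [normalize, ← ha, h0]; simp
  have hϑ1 : ‖sqrtMul Q (normalize Q θhat)‖ ≤ 1 := by
    rcases hsn with h0 | h1
    · have : sqrtMul Q (0 : EuclideanSpace ℝ (Fin d)) = 0 := by
        simpa using sqrtMul_smul (Q := Q) 0 0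
      rw [hϑ0 h0, this]; simp
    · rw [← h1]; exact norm_le_l1norm _
  -- A vector of unit `ℓ¹` norm has Euclidean norm at least `1/√d`, and `√d h ≤ A`.
  have hϑ : normalize Q θhat = 0 ∨ (sqrtMul Q (normalize Q θhat) ≠ 0 ∧
      h ≤ A * ‖sqrtMul Q (normalize Q θhat)‖) := by
    rcases hsn with h0 | h1
    · exact Or.inl (hϑ0 h0)
    · have h3 := l1norm_le_sqrt_mul_norm (sqrtMul Q (normalize Q θhat))
      rw [h1] at h3
      refine Or.inr ⟨fun hz => ?_, ?_⟩
      · rw [hz] at h3; norm_num at h3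
      · calc h = h * 1 := by ring
          _ ≤ h * (√d * ‖sqrtMul Q (normalize Q θhat)‖) := by gcongr
          _ = (√d * h) * ‖sqrtMul Q (normalize Q θhat)‖ := by ring
          _ ≤ _ := by gcongr
  refine (lintegral_kernelRegression_error_le hQ.posSemidef hn hf hfb hf' hh hh1 (by positivity)
    (by positivity : 0 ≤ a / μ) hA0 hdec hϑ1 hϑ ν h2 h0 hσ hv).trans ?_
  refine ENNReal.ofReal_le_ofReal ?_
  have hE : ‖sqrtMul Q ((1 / μ) • Δ)‖ ≤ √Cmax / μ₀ * ‖Δ‖ := by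
    rw [sqrtMul_smul, norm_smul, Real.norm_eq_abs, abs_of_pos (by positivity)]
    calc 1 / μ * ‖sqrtMul Q Δ‖ ≤ 1 / μ₀ * (√Cmax * ‖Δ‖) := by gcongr
      _ = _ := by ring
  have hκ : a / μ * h ≤ h + A * (√Cmax / μ₀ * ‖Δ‖) := by
    calc a / μ * h ≤ (μ + √d * (√Cmax * ‖Δ‖)) / μ * h := by gcongr
      _ = h + (√d * h) * (1 / μ * (√Cmax * ‖Δ‖)) := by field_simp
      _ ≤ h + A * (1 / μ₀ * (√Cmax * ‖Δ‖)) := by gcongr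
      _ = _ := by ring
  have e12 : 12 * Real.exp (A ^ 2 / 4) / √(n * h) = 12 * Real.exp (A ^ 2 / 4) * h := by
    rw [div_eq_mul_one_div, hsq]
  rw [e12]
  set E := √Cmax / μ₀ * ‖Δ‖ with hEdef
  -- Nonnegative cross terms, added so that `h` and `‖Δ‖` carry the same constant.
  have hrest : 0 ≤ (2 * Lf + Lf' + 12 * (Lf + σ) * Real.exp (A ^ 2 / 4)) * ‖Δ‖ := by positivity
  have hrest' : 0 ≤ Lf' * (√Cmax / μ₀) * (2 * A + 3) * h := by positivity
  calc _ ≤ 2 * Lf * h + Lf' * ((h + A * E) + (A + 3) * E) +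
        (Lf + σ) * (12 * Real.exp (A ^ 2 / 4) * h) := by gcongr
    _ = (2 * Lf + Lf' + 12 * (Lf + σ) * Real.exp (A ^ 2 / 4)) * h +
        Lf' * (√Cmax / μ₀) * (2 * A + 3) * ‖Δ‖ := by rw [hEdef]; ring
    _ ≤ _ := by rw [errorConst]; nlinarith

end Plugin

end SingleIndex

/-! ### The main theorem -/

open SingleIndex in
theorem theorem6
    -- the constants on which the bound may depend
    (Lf Lf' σ M Cmax μ₀ A B : ℝ) (hLf : 0 < Lf) (hLf' : 0 < Lf') (hσ : 0 ≤ σ) (hM : 0 < M)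
    (hCmax : 0 < Cmax) (hμ₀ : 0 < μ₀) (hA : 0 < A) (hB : 0 < B) :
    ∃ C : ℝ, ∀ (n d : ℕ), (d : ℝ) ^ 6 ≤ A * n →
      -- the single index model: link function, Gaussian design, true parameter
      ∀ (f : ℝ → ℝ), ContDiff ℝ 1 f → (∀ t, |f t| ≤ Lf) → (∀ t, |deriv f t| ≤ Lf') →
      ∀ (m : EuclideanSpace ℝ (Fin d)) (Q : Matrix (Fin d) (Fin d) ℝ) (hQ : Q.PosDef),
        (∀ j, hQ.isHermitian.eigenvalues j ≤ Cmax) →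
        (∀ j, ∫ x, (score (gaussianDensity m Q) x j) ^ 2 ∂(multivariateGaussian m Q) ≤ M) →
      ∀ (θ : EuclideanSpace ℝ (Fin d)), l1norm (sqrtMul Q θ) = 1 →
        μ₀ ≤ ∫ x, deriv f (inner ℝ x θ) ∂(multivariateGaussian m Q) →
      -- `2 n` independent samples, in two batches, and an independent new context `X`
      ∀ (Ω : Type*) [MeasurableSpace Ω] (P : Measure Ω) [IsProbabilityMeasure P]
        (x : Fin n ⊕ Fin n → Ω → EuclideanSpace ℝ (Fin d)) (η y : Fin n ⊕ Fin n → Ω → ℝ)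
        (X : Ω → EuclideanSpace ℝ (Fin d)),
        (∀ i, HasLaw (x i) (multivariateGaussian m Q) P) →
        (∀ i, MemLp (η i) 2 P ∧ ∫ ω, η i ω ∂P = 0 ∧ variance (η i) P ≤ σ ^ 2) →
        (∀ i, IndepFun (x i) (η i) P) →
        iIndepFun (fun i ω => (x i ω, η i ω)) P →
        HasLaw X (multivariateGaussian m Q) P →
        IndepFun X (fun ω i => (x i ω, η i ω)) P →
        (∀ i ω, y i ω = f (inner ℝ (x i ω) θ) + η i ω) →
      -- the Stein estimator from the first batch
      ∀ (δ τ : ℝ), 0 < δ → δ < 1 → Real.log (1 / δ) ≤ B * (n : ℝ) ^ ((1 : ℝ) / 3) →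
        τ = Real.sqrt (3 * (σ ^ 2 + Lf ^ 2) * M * n / Real.log (2 * d / δ)) →
      ∀ (θhat : Ω → EuclideanSpace ℝ (Fin d)),
        (∀ ω, IsMinOn (steinObjective (score (gaussianDensity m Q)) τ 0
          (fun i => x (Sum.inl i) ω) (fun i => y (Sum.inl i) ω)) Set.univ (θhat ω)) →
      -- expectation over `X` and the second batch, for a realization of the first batch
      (1 - δ ≤ P.real {ω |
          Integrable (fun ω' => predictionError f θ m (normalize Q (θhat ω))
            (fun i => x (Sum.inr i) ω') (fun i => y (Sum.inr i) ω') (X ω')) P ∧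
          ∫ ω', predictionError f θ m (normalize Q (θhat ω))
            (fun i => x (Sum.inr i) ω') (fun i => y (Sum.inr i) ω') (X ω') ∂P
              ≤ C * (Real.sqrt d * (n : ℝ) ^ (-(1 : ℝ) / 3))}) ∧
      -- expectation over all the randomness
      Integrable (fun ω => predictionError f θ m (normalize Q (θhat ω))
          (fun i => x (Sum.inr i) ω) (fun i => y (Sum.inr i) ω) (X ω)) P ∧
      ∫ ω, predictionError f θ m (normalize Q (θhat ω))
          (fun i => x (Sum.inr i) ω) (fun i => y (Sum.inr i) ω) (X ω) ∂P
            ≤ C * (Real.sqrt d * (n : ℝ) ^ (-(1 : ℝ) / 3)) := by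
  have hA1 : 1 ≤ max A 1 := le_max_right _ _
  set A' := max A 1 with hA'
  set V := (σ ^ 2 + Lf ^ 2) * M with hV
  have hV0 : 0 < V := by positivity
  set R := √(V * (2 * A' + B) / 3) with hR
  set K := errorConst Lf Lf' σ Cmax μ₀ A' with hK
  have hK0 : 0 ≤ K := by rw [hK, errorConst]; positivity
  -- In units of `√d h`: `1` accounts for `h` itself, `5 R` for `‖Δ‖` on the good event (where `V/τ
  -- ≤ R h`), and `√(V + R²)` for the mean of `‖Δ‖`.
  refine ⟨K * (1 + 5 * R + √(V + R ^ 2)), fun n d hnd f hf hfb hf' m Q hQ hQC hM2 θ hθ hμ Ω _ P _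
    x η y X hx hη hxη hind hX hXind hy δ τ hδ hδ1 hB' hτ θhat hmin => ?_⟩
  -- In dimension `0` the normalization of `θ` fails; then `d ≥ 1` and the growth condition exclude
  -- `n = 0`.
  have hd : 0 < d := by
    rcases Nat.eq_zero_or_pos d with rfl | h0
    · simp [l1norm] at hθ
    · exact h0
  have hd' : (1 : ℝ) ≤ d := by exact_mod_cast hd
  have hn : 0 < n := by
    rcases Nat.eq_zero_or_pos n with rfl | h0
    · have : (1 : ℝ) ≤ (d : ℝ) ^ 6 := one_le_pow₀ hd'
      simp at hnd; linarith
    · exact h0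
  have hn' : (0 : ℝ) < n := by exact_mod_cast hn
  have hdA := dim_mul_bandwidth_le hn hnd
  obtain ⟨hτ0, hτ2, hρ⟩ := moment_div_truncation_le hn hd hV0 hδ hδ1 hB' hdA
    (by rw [hτ, hV]; ring_nf : τ = √(3 * V * n / Real.log (2 * d / δ)))
  have hh := bandwidth_pos hn
  have hh1 := bandwidth_le_one hn
  have hh3 := natCast_mul_bandwidth_pow_three hn
  set h := (n : ℝ) ^ (-(1 : ℝ) / 3) with hhdef
  set μ := ∫ x, deriv f (inner ℝ x θ) ∂(multivariateGaussian m Q) with hμdef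
  set D := multivariateGaussian m Q with hD
  have hfm : Measurable f := hf.continuous.measurable
  have hxm : ∀ i, AEMeasurable (x i) P := fun i => (hx i).aemeasurable
  have hηm : ∀ i, AEMeasurable (η i) P := fun i => (hη i).1.aestronglyMeasurable.aemeasurable
  have hXm : AEMeasurable X P := hX.aemeasurable
  obtain rfl : y = fun i ω => f (inner ℝ (x i ω) θ) + η i ω := by
    ext i ω; exact hy i ω
  -- the laws of the noises and of the samples
  set ν : Fin n ⊕ Fin n → Measure ℝ := fun i => P.map (η i) with hν
  have hνP : ∀ i, IsProbabilityMeasure (ν i) := fun i => Measure.isProbabilityMeasure_map (hηm i)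
  have hpair : ∀ i, HasLaw (fun ω => (x i ω, η i ω)) (D.prod (ν i)) P := fun i =>
    (hxη i).hasLaw_prod (hx i) ⟨hηm i, rfl⟩
  have hν2 : ∀ i, MemLp id 2 (ν i) := fun i =>
    (memLp_map_measure_iff (by fun_prop) (hηm i)).2 (hη i).1
  have hν0 : ∀ i, ∫ t, t ∂ν i = 0 := fun i => by
    rw [hν, integral_map (hηm i) (by fun_prop)]; exact (hη i).2.1
  have hνσ : ∀ i, variance id (ν i) ≤ σ ^ 2 := fun i => by
    rw [hν, variance_map (by fun_prop) (hηm i)]; exact (hη i).2.2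
  set pe : EuclideanSpace ℝ (Fin d) → (Fin n → EuclideanSpace ℝ (Fin d) × ℝ) →
      EuclideanSpace ℝ (Fin d) → ℝ := fun t z u => predictionError f θ m (normalize Q t)
    (fun i => (z i).1) (fun i => f (inner ℝ (z i).1 θ) + (z i).2) u with hpe
  have hpem : Measurable fun w : EuclideanSpace ℝ (Fin d) ×
      (Fin n → EuclideanSpace ℝ (Fin d) × ℝ) × EuclideanSpace ℝ (Fin d) => pe w.1 w.2.1 w.2.2 := by
    have h1 := measurable_normalize (Q := Q)
    exact (measurable_predictionError (n := n) (θ := θ) (m := m) hfm).comp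
      (f := fun w : EuclideanSpace ℝ (Fin d) × (Fin n → EuclideanSpace ℝ (Fin d) × ℝ) ×
        EuclideanSpace ℝ (Fin d) => (normalize Q w.1, (fun i => (w.2.1 i).1),
          (fun i => f (inner ℝ (w.2.1 i).1 θ) + (w.2.1 i).2), w.2.2)) (by fun_prop)
  have hkey : ∀ t, ∫⁻ u, ∫⁻ z, ENNReal.ofReal (pe t z u)
      ∂Measure.pi (fun i => D.prod (ν (Sum.inr i))) ∂D ≤
        ENNReal.ofReal (K * (h + ‖t - μ • θ‖)) := fun t => by
    have hz : ∀ u, Measurable fun z => ENNReal.ofReal (pe t z u) := fun u =>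
      (hpem.comp (measurable_const.prodMk (measurable_id.prodMk measurable_const) :
        Measurable fun z => (t, z, u))).ennreal_ofReal
    simp_rw [fun u => lintegral_pi_prod (fun _ : Fin n => D) (fun i => ν (Sum.inr i)) (hz u)]
    exact lintegral_predictionError_normalize_le hn hd hQ hQC hf hfb hf' hdA hθ hμ₀ hμ
      (fun i => ν (Sum.inr i)) (fun i => hν2 _) (fun i => hν0 _) hσ (fun i => hνσ _) t
  -- the estimated index
  set T : (Fin n → EuclideanSpace ℝ (Fin d) × ℝ) → EuclideanSpace ℝ (Fin d) := fun z =>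
    steinEstimator (score (gaussianDensity m Q)) τ (fun i => (z i).1)
      (fun i => f (inner ℝ (z i).1 θ) + (z i).2) with hT
  have hTm : Measurable T := (measurable_steinEstimator (n := n) (m := m) hQ hτ0).comp
    (f := fun z : Fin n → EuclideanSpace ℝ (Fin d) × ℝ =>
      ((fun i => (z i).1), fun i => f (inner ℝ (z i).1 θ) + (z i).2)) (by fun_prop)
  have hTeq : ∀ ω, θhat ω = T fun i => (x (Sum.inl i) ω, η (Sum.inl i) ω) := fun ω =>
    eq_steinEstimator_of_isMinOn (hmin ω)
  obtain ⟨hmean, hdev⟩ := steinEstimator_error (Δ := fun ω => θhat ω - μ • θ) hn hτ0 hQ hf hfb hf'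
    (fun h0 => by rw [h0] at hθ; simp [l1norm] at hθ) hM2 (fun i => hx (Sum.inl i))
    (fun i => hη (Sum.inl i)) (fun i => hxη (Sum.inl i)) (hind.precomp Sum.inl_injective) hμdef hV
    (fun ω => by simp only [hTeq, hT])
  have hsd : 1 ≤ √d := Real.one_le_sqrt.2 hd'
  have hR0 : 0 ≤ R := Real.sqrt_nonneg _
  have hbatch := fun {G} => lintegral_prod_batches (G := G) (fun i => D.prod (ν i)) hpair hind hX
    hXind
  have hmeas2 : AEMeasurable (fun ω => ((fun i => (x (Sum.inr i) ω, η (Sum.inr i) ω) :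
      Fin n → EuclideanSpace ℝ (Fin d) × ℝ), X ω)) P := by fun_prop
  have hmeas1 : AEMeasurable θhat P := by
    have h1 : AEMeasurable (fun ω => (fun i => (x (Sum.inl i) ω, η (Sum.inl i) ω) :
      Fin n → EuclideanSpace ℝ (Fin d) × ℝ)) P := by fun_prop
    exact (hTm.comp_aemeasurable h1).congr (ae_of_all _ fun ω => (hTeq ω).symm)
  have hC0 : 0 ≤ K * (1 + 5 * R + √(V + R ^ 2)) * (√d * h) := by positivity
  refine ⟨?_, ?_⟩
  · set bad := {ω | √d * (5 * (V / τ)) < ‖θhat ω - μ • θ‖}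
    have hbad : P.real bad ≤ δ := by
      refine (hdev (5 * (V / τ)) (by positivity)).trans (le_of_eq ?_)
      -- The level `5 V/τ` turns the exponent into `(2 - 5) n V/τ² = -log(2d/δ)`, which absorbs the
      -- factor `2d` of the union bound.
      have e : 2 * n * V / τ ^ 2 - n * (5 * (V / τ)) / τ = -Real.log (2 * d / δ) := by
        have : 2 * n * V / τ ^ 2 - n * (5 * (V / τ)) / τ = -3 * (n * V / τ ^ 2) := by
          field_simp; ring
        rw [this, hτ2]; ring
      rw [e, Real.exp_neg, Real.exp_log (by positivity)]
      field_simp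
    refine le_trans ?_ (measureReal_mono (s₁ := badᶜ) fun ω hω => ?_)
    -- Subadditivity suffices here, so the bad event need not be measurable.
    · have h1 := measureReal_union_le (μ := P) bad badᶜ
      rw [Set.union_compl_self, probReal_univ] at h1
      linarith
    · have hω' : ‖θhat ω - μ • θ‖ ≤ √d * (5 * (V / τ)) := not_lt.1 hω
      refine integrable_and_integral_le ?_ (fun ω' => abs_nonneg _) hC0 ?_
      · exact hpem.comp_aemeasurable (f := fun ω' => (θhat ω, (fun i => (x (Sum.inr i) ω',
          η (Sum.inr i) ω')), X ω')) (aemeasurable_const.prodMk hmeas2)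
      -- The estimate is frozen at `ω`, so the integrand ignores the first batch and the outer
      -- integral is that of a constant.
      · have hG : Measurable fun w : (Fin n → EuclideanSpace ℝ (Fin d) × ℝ) ×
            (Fin n → EuclideanSpace ℝ (Fin d) × ℝ) × EuclideanSpace ℝ (Fin d) =>
            ENNReal.ofReal (pe (θhat ω) w.2.1 w.2.2) :=
          (hpem.comp (measurable_const.prodMk measurable_snd)).ennreal_ofReal
        have h1 := hbatch hG
        simp only [lintegral_const, measure_univ, mul_one] at h1
        refine (le_of_eq h1).trans ((hkey (θhat ω)).trans (ENNReal.ofReal_le_ofReal ?_))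
        rw [mul_assoc]
        refine mul_le_mul_of_nonneg_left ?_ hK0
        have h2 : ‖θhat ω - μ • θ‖ ≤ 5 * R * (√d * h) := by
          calc _ ≤ √d * (5 * (V / τ)) := hω'
            _ ≤ √d * (5 * (R * h)) := by gcongr
            _ = _ := by ring
        have h3 : h ≤ √d * h := le_mul_of_one_le_left hh.le hsd
        have h4 : 0 ≤ √(V + R ^ 2) * (√d * h) := by positivity
        linarith
  · refine integrable_and_integral_le ?_ (fun ω' => abs_nonneg _) hC0 ?_
    · exact hpem.comp_aemeasurable (f := fun ω' => (θhat ω', (fun i => (x (Sum.inr i) ω',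
          η (Sum.inr i) ω')), X ω')) (hmeas1.prodMk hmeas2)
    -- Here the direction is the function `T` of the first batch; the bound `hkey` holds pointwise
    -- in it and is then averaged using `hmean`.
    · have hG : Measurable fun w : (Fin n → EuclideanSpace ℝ (Fin d) × ℝ) ×
          (Fin n → EuclideanSpace ℝ (Fin d) × ℝ) × EuclideanSpace ℝ (Fin d) =>
          ENNReal.ofReal (pe (T w.1) w.2.1 w.2.2) :=
        (hpem.comp ((hTm.comp measurable_fst).prodMk measurable_snd)).ennreal_ofReal
      have h1 := hbatch hG
      simp only [← hTeq] at h1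
      refine (le_of_eq h1).trans ((lintegral_mono fun ω => hkey (θhat ω)).trans ?_)
      have h2 : ∀ ω, ENNReal.ofReal (K * (h + ‖θhat ω - μ • θ‖)) =
          ENNReal.ofReal (K * h) + ENNReal.ofReal K * ENNReal.ofReal ‖θhat ω - μ • θ‖ := fun ω => by
        rw [mul_add, ENNReal.ofReal_add (by positivity) (by positivity),
          ENNReal.ofReal_mul (q := ‖θhat ω - μ • θ‖) hK0]
      simp_rw [h2]
      rw [lintegral_add_left measurable_const, lintegral_const, measure_univ, mul_one,
        lintegral_const_mul' _ _ ENNReal.ofReal_ne_top]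
      refine (add_le_add_right (mul_le_mul_right hmean _) _).trans ?_
      rw [← ENNReal.ofReal_mul hK0, ← ENNReal.ofReal_add (by positivity) (by positivity)]
      refine ENNReal.ofReal_le_ofReal ?_
      have h3 : √(d * (V / n + (V / τ) ^ 2)) ≤ √(V + R ^ 2) * (√d * h) :=
        sqrt_meanSquare_le hn hV0.le (by positivity) hρ
      have h4 : h ≤ √d * h := le_mul_of_one_le_left hh.le hsd
      have h5 : 0 ≤ 5 * R * (√d * h) := by positivity
      calc _ = K * (h + √(d * (V / n + (V / τ) ^ 2))) := by ring
        _ ≤ K * ((1 + 5 * R + √(V + R ^ 2)) * (√d * h)) :=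
          mul_le_mul_of_nonneg_left (by linarith) hK0
        _ = _ := by ring
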